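/- Setting. There are $m\ge 1$ candidates and $n\ge 1$ voters; each vote is a linear order on the candidates. Under the positional scoring rule with score vector $(\alpha_1,\dots,\alpha_m)$ a candidate receives $\alpha_i$ points from each vote that ranks it in position $i$; the winner is the candidate with the highest total score, and ties are broken in favour of the tied candidate that comes first in a predetermined linear order $\succ_t$ on the candidates. *Borda* is the rule with vector $(m-1,m-2,\dots,1,0)$; *$k$-approval*, $1\le k<m$, is the rule with $\alpha_1=\dots=\alpha_k=1$ and $\alpha_{k+1}=\dots=\alpha_m=0$ (plurality is $k=1$, veto is $k=m-1$). The order $\succ_t$, and for $k$-approval also the number $k$, belong to the description of the voting rule and are part of the input. Let $r$ be a voting rule, $(\succ_i)_{i\in V}$ the reported profile of a set $V$ of voters, and $x$ its winner under $r$. A set $M\subseteq V$ is a *coalition of possible manipulators against* a candidate $y$ if $y\ne x$ and there are votes $(\succ'_j)_{j\in M}$, each ranking $x$ above $y$, such that $y$ is the winner under $r$ of the profile in which the voters $j\in M$ vote $\succ'_j$ and all other voters vote $\succ_j$. It is a *coalition of possible manipulators* if it is one against some candidate $y$. Consider the following decision problems, in each of which the voting rule $r$ and the reported profile are part of the input.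 * CPMW: given moreover $M\subseteq V$ and a candidate $y$, is $M$ a coalition of possible manipulators against $y$? * CPM: given moreover $M\subseteq V$, is $M$ a coalition of possible manipulators? * CPMSW: given moreover a candidate $y$ and an integer $\ell\ge 0$, is there a coalition $M\subseteq V$ of possible manipulators against $y$ with $|M|\le \ell$? * CPMS: given moreover an integer $\ell\ge 0$, is there a coalition $M\subseteq V$ of possible manipulators with $|M|\le \ell$? **Corollary.** For the Borda rule, and for the $k$-approval rules (all $1\le k<m$, including plurality), all four problems CPMW, CPM, CPMSW and CPMS are in $\mathsf{P}$: each is decided by a Turing machine in time polynomial in the length of the input, in which the votes are listed one by one as rankings and numbers are written in binary. -/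

import Mathlib

namespace Manip

/-! ### Elections, positional scoring rules, tie breaking -/

/-- A preference (linear order) over the `m` candidates `Fin m`, written as a ranking:
`σ p` is the candidate at position `p` (position `0` is the top), and `σ.symm c` is the position
of the candidate `c`. -/
abbrev Pref (m : ℕ) : Type := Equiv.Perm (Fin m)

/-- A preference profile of `n` voters over `m` candidates. -/
abbrev Profile (n m : ℕ) : Type := Fin n → Pref m

/-- The vote `σ` strictly prefers `a` to `b`. -/
def Pref.Prefers {m : ℕ} (σ : Pref m) (a b : Fin m) : Prop := σ.symm a < σ.symm b

/-- The score of candidate `c`: each vote contributes `α p`, where `p` is the position of `c`. -/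
def score {n m : ℕ} (α : Fin m → ℕ) (P : Profile n m) (c : Fin m) : ℕ :=
  ∑ v, α ((P v).symm c)

/-- The positional scoring correspondence: the candidates of maximum score. -/
def coWinners {n m : ℕ} (α : Fin m → ℕ) (P : Profile n m) : Finset (Fin m) :=
  Finset.univ.filter fun c => ∀ d, score α P d ≤ score α P c

theorem coWinners_nonempty {n m : ℕ} (hm : 0 < m) (α : Fin m → ℕ) (P : Profile n m) :
    (coWinners α P).Nonempty := by
  have : Nonempty (Fin m) := ⟨⟨0, hm⟩⟩
  obtain ⟨c, -, hc⟩ := Finset.exists_max_image (Finset.univ : Finset (Fin m)) (score α P)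
    Finset.univ_nonempty
  exact ⟨c, by simpa [coWinners] using hc⟩

/-- Lexicographic tie breaking: the element of the nonempty set `S` that the predetermined
preference `t` ranks first. -/
def tieBreak {m : ℕ} (t : Pref m) (S : Finset (Fin m)) (hS : S.Nonempty) : Fin m :=
  t ((S.map t.symm.toEmbedding).min' (hS.map))

/-- The voting rule given by the score vector `α` and lexicographic tie breaking with respect
to `t`. -/
def scoringRule {n m : ℕ} (hm : 0 < m) (α : Fin m → ℕ) (t : Pref m) (P : Profile n m) : Fin m :=
  tieBreak t (coWinners α P) (coWinners_nonempty hm α P)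

/-! ### Coalitions of possible manipulators -/

/-- `M` is a coalition of possible manipulators against `y` with respect to the voting rule `r`,
for the reported profile `P`. Only the values of `P'` on `M` are used, so `P'` stands for a
profile of the voters in `M`; `M.piecewise P' P` is `P'` on `M` and `P` off `M`. -/
def IsCoalitionAgainst {n m : ℕ} (r : Profile n m → Fin m) (P : Profile n m)
    (M : Finset (Fin n)) (y : Fin m) : Prop :=
  y ≠ r P ∧ ∃ P' : Profile n m,
    (∀ j ∈ M, (P' j).Prefers (r P) y) ∧ r (M.piecewise P' P) = y

/-- `M` is a coalition of possible manipulators with respect to the voting rule `r`. -/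
def IsCoalition {n m : ℕ} (r : Profile n m → Fin m) (P : Profile n m)
    (M : Finset (Fin n)) : Prop :=
  ∃ y, IsCoalitionAgainst r P M y

/-! ### Families of scoring rules: Borda and approval -/

/-- A family of scoring vectors: for `m` candidates the admissible parameters are `Param m`, the
vector belonging to `a : Param m` is `vec m a`, and `enc m a` is how `a` is written in an input. -/
structure ScoringFamily where
  Param : ℕ → Type
  vec : ∀ m, Param m → Fin m → ℕ
  enc : ∀ m, Param m → List ℕ
  enc_injective : ∀ m, Function.Injective (enc m)

/-- Borda: the score vector is `(m-1, m-2, …, 1, 0)`; there is no parameter. -/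
def borda : ScoringFamily where
  Param _ := Unit
  vec m _ p := m - 1 - p
  enc _ _ := []
  enc_injective _ _ _ _ := rfl

/-- `k`-approval, `1 ≤ k < m`: the first `k` positions score `1`, the others `0`.
The number `k` is part of the input. -/
def approval : ScoringFamily where
  Param m := {k : ℕ // 1 ≤ k ∧ k < m}
  vec _ k p := if (p : ℕ) < k.1 then 1 else 0
  enc _ k := [k.1]
  enc_injective _ a b h := by
    apply Subtype.ext
    simpa using h

/-- An election for a family of scoring rules: numbers of candidates and voters, the voting rule
(parameter of the score vector and tie-breaking preference), and the reported profile. -/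
structure Election (F : ScoringFamily) where
  m : ℕ
  n : ℕ
  m_pos : 0 < m
  n_pos : 0 < n
  param : F.Param m
  tie : Pref m
  votes : Profile n m

/-- The voting rule of an election, as a map on all profiles of its voters. -/
def Election.rule {F : ScoringFamily} (E : Election F) : Profile E.n E.m → Fin E.m :=
  scoringRule E.m_pos (F.vec E.m E.param) E.tie

/-! ### Encoding of inputs

Numbers are written in binary and terminated by a comma; a list is terminated by `ket`. -/

open Computability in
def encodeNumber (a : ℕ) : List Γ' := (encodeNat a).map Γ'.bit ++ [Γ'.comma]

open Computability in
def encodeList (l : List ℕ) : List Γ' := l.flatMap encodeNumber ++ [Γ'.ket]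

open Computability in
def encodeLists (L : List (List ℕ)) : List Γ' := L.flatMap encodeList

/-- A preference is written as the list of the candidates from the first to the last position. -/
def Pref.toList {m : ℕ} (σ : Pref m) : List ℕ := List.ofFn fun p => (σ p : ℕ)

/-- A set of voters is written as its characteristic vector. -/
def voterSetToList {n : ℕ} (M : Finset (Fin n)) : List ℕ :=
  List.ofFn fun v => if v ∈ M then 1 else 0

/-- An election is written as the parameter of the rule, the tie-breaking preference, and the
votes. -/
def Election.toLists {F : ScoringFamily} (E : Election F) : List (List ℕ) :=
  F.enc E.m E.param :: E.tie.toList :: List.ofFn fun v => (E.votes v).toList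

theorem encodeNumber_append_inj {a b : ℕ} {s t : List Computability.Γ'}
    (h : encodeNumber a ++ s = encodeNumber b ++ t) : a = b ∧ s = t := by
  have key : ∀ (u v : List Bool), u.map Computability.Γ'.bit ++ (Computability.Γ'.comma :: s) =
      v.map Computability.Γ'.bit ++ (Computability.Γ'.comma :: t) → u = v ∧ s = t := by
    intro u
    induction u with
    | nil => intro v h; cases v <;> simp_all
    | cons x u ih =>
      intro v h
      cases v with
      | nil => simp_all
      | cons y v =>
        simp only [List.map_cons, List.cons_append, List.cons.injEq,
          Computability.Γ'.bit.injEq] at h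
        obtain ⟨h1, h2⟩ := ih v h.2
        exact ⟨by rw [h.1, h1], h2⟩
  obtain ⟨h1, h2⟩ := key _ _ (by simpa [encodeNumber] using h)
  exact ⟨Computability.encodingNatBool.encode_injective h1, h2⟩

theorem encodeNumber_ne_ket (a : ℕ) (s t : List Computability.Γ') :
    encodeNumber a ++ s ≠ Computability.Γ'.ket :: t := by
  unfold encodeNumber
  cases Computability.encodeNat a <;> simp

theorem encodeList_append_inj {l l' : List ℕ} {s t : List Computability.Γ'}
    (h : encodeList l ++ s = encodeList l' ++ t) : l = l' ∧ s = t := by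
  induction l generalizing l' with
  | nil =>
    cases l' with
    | nil => simpa [encodeList] using h
    | cons b l' =>
      exact absurd (by simpa [encodeList] using h.symm) (encodeNumber_ne_ket b _ _)
  | cons a l ih =>
    cases l' with
    | nil => exact absurd (by simpa [encodeList] using h) (encodeNumber_ne_ket a _ _)
    | cons b l' =>
      have h' : encodeNumber a ++ (encodeList l ++ s) = encodeNumber b ++ (encodeList l' ++ t) := by
        simpa [encodeList] using h
      obtain ⟨h1, h2⟩ := encodeNumber_append_inj h'
      obtain ⟨h3, h4⟩ := ih h2
      exact ⟨by rw [h1, h3], h4⟩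

theorem encodeLists_injective : Function.Injective encodeLists := by
  intro L
  induction L with
  | nil =>
    intro L' h
    cases L' with
    | nil => rfl
    | cons l L' =>
      have := congrArg List.length h
      simp [encodeLists, encodeList] at this
  | cons l L ih =>
    intro L' h
    cases L' with
    | nil =>
      have := congrArg List.length h
      simp [encodeLists, encodeList] at this
    | cons l' L' =>
      obtain ⟨h1, h2⟩ := encodeList_append_inj
        (s := encodeLists L) (t := encodeLists L') (by simpa [encodeLists] using h)
      rw [h1, ih h2]

theorem Pref.toList_injective {m : ℕ} : Function.Injective (Pref.toList (m := m)) := by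
  intro σ τ h
  apply Equiv.ext
  intro p
  exact Fin.ext (congrFun (List.ofFn_injective h) p)

theorem voterSetToList_injective {n : ℕ} : Function.Injective (voterSetToList (n := n)) := by
  intro M N h
  ext v
  have := congrFun (List.ofFn_injective h) v
  by_cases h1 : v ∈ M <;> by_cases h2 : v ∈ N <;> simp_all

theorem Election.toLists_injective {F : ScoringFamily} :
    Function.Injective (Election.toLists (F := F)) := by
  rintro ⟨m, n, hm, hn, a, t, P⟩ ⟨m', n', hm', hn', a', t', P'⟩ h
  simp only [Election.toLists, List.cons.injEq] at h
  obtain ⟨h1, h2, h3⟩ := h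
  obtain rfl : m = m' := by simpa [Pref.toList] using congrArg List.length h2
  obtain rfl : n = n' := by simpa using congrArg List.length h3
  obtain rfl := F.enc_injective m h1
  obtain rfl := Pref.toList_injective h2
  obtain rfl : P = P' := funext fun v =>
    Pref.toList_injective (congrFun (List.ofFn_injective h3) v)
  rfl

/-! ### Decision problems and the class P -/

/-- A decision problem: instances, their encoding as words, and the yes-instances. -/
structure DecisionProblem where
  Inst : Type
  encode : Inst → List Computability.Γ'
  encode_injective : Function.Injective encode
  Yes : Inst → Prop

open Classical in
/-- A decision problem is in P: a Turing machine that gets an encoded instance halts within a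
number of steps polynomial in the length of its input, with the correct yes/no answer. -/
def DecisionProblem.InP (D : DecisionProblem) : Prop :=
  Nonempty (Turing.TM2ComputableInPolyTime D.encode Computability.encodeBool
    fun I => decide (D.Yes I))

/-- CPMW: given an election, a set `M` of voters and a candidate `y`, is `M` a coalition of
possible manipulators against `y`? -/
def CPMW (F : ScoringFamily) : DecisionProblem where
  Inst := Σ E : Election F, Finset (Fin E.n) × Fin E.m
  encode I := encodeLists (voterSetToList I.2.1 :: [(I.2.2 : ℕ)] :: I.1.toLists)
  encode_injective := by
    rintro ⟨E, M, y⟩ ⟨E', M', y'⟩ h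
    have h := encodeLists_injective h
    simp only [List.cons.injEq, and_true] at h
    obtain rfl := Election.toLists_injective h.2.2
    obtain rfl := voterSetToList_injective h.1
    obtain rfl := Fin.ext h.2.1
    rfl
  Yes I := IsCoalitionAgainst I.1.rule I.1.votes I.2.1 I.2.2

/-- CPM: given an election and a set `M` of voters, is `M` a coalition of possible
manipulators? -/
def CPM (F : ScoringFamily) : DecisionProblem where
  Inst := Σ E : Election F, Finset (Fin E.n)
  encode I := encodeLists (voterSetToList I.2 :: I.1.toLists)
  encode_injective := by
    rintro ⟨E, M⟩ ⟨E', M'⟩ h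
    have h := encodeLists_injective h
    simp only [List.cons.injEq] at h
    obtain rfl := Election.toLists_injective h.2
    obtain rfl := voterSetToList_injective h.1
    rfl
  Yes I := IsCoalition I.1.rule I.1.votes I.2

/-- CPMSW: given an election, a candidate `y` and a number `k`, is there a coalition of possible
manipulators against `y` of size at most `k`? -/
def CPMSW (F : ScoringFamily) : DecisionProblem where
  Inst := Σ E : Election F, Fin E.m × ℕ
  encode I := encodeLists ([(I.2.1 : ℕ)] :: [I.2.2] :: I.1.toLists)
  encode_injective := by
    rintro ⟨E, y, k⟩ ⟨E', y', k'⟩ h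
    have h := encodeLists_injective h
    simp only [List.cons.injEq, and_true] at h
    obtain rfl := Election.toLists_injective h.2.2
    obtain rfl := Fin.ext h.1
    obtain rfl := h.2.1
    rfl
  Yes I := ∃ M : Finset (Fin I.1.n), M.card ≤ I.2.2 ∧
    IsCoalitionAgainst I.1.rule I.1.votes M I.2.1

/-- CPMS: given an election and a number `k`, is there a coalition of possible manipulators of
size at most `k`? -/
def CPMS (F : ScoringFamily) : DecisionProblem where
  Inst := Σ _ : Election F, ℕ
  encode I := encodeLists ([I.2] :: I.1.toLists)
  encode_injective := by
    rintro ⟨E, k⟩ ⟨E', k'⟩ h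
    have h := encodeLists_injective h
    simp only [List.cons.injEq, and_true] at h
    obtain rfl := Election.toLists_injective h.2
    obtain rfl := h.1
    rfl
  Yes I := ∃ M : Finset (Fin I.1.n), M.card ≤ I.2 ∧ IsCoalition I.1.rule I.1.votes M

end Manip

/-!
Let `x` be the winner and let `y` be the candidate that the manipulators elect.

If the smallest gap `g` of the score vector is the one between its first two entries, as for Borda
and for `k`-approval with `k ≠ 1`, then each manipulator does best to rank `x` first and `y` second:
no vote ranking `x` above `y` gives `x` a smaller lead over `y`, and no third candidate gains, so
that `y` wins as soon as it beats `x`. The voter `v` thus contributes the decrease of the lead of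
`x` over `y` in its vote, and the best coalition of size `k` consists of the `k` voters with the
largest decreases. Their sum is computed without sorting, as `∑ j, min k #{v | j < decrease of v}`.

Under plurality, the manipulators may top-rank every candidate but `y`. They succeed if and only if
no other candidate beats `y` without their votes and all `n` votes fit below the score of `y`, so a
smallest coalition takes from each other candidate the votes by which it beats `y`.

Each criterion is evaluated with sums, products and comparisons of numbers that are polynomial in
the length of the input. Programs over unary counters do this, and a Turing machine with one stack
per counter executes them. A number written in binary can exceed this bound, but it only has to be
known up to the length of the input.
-/

namespace Manip

section Machine

open Turing Computability StateTransition

/-! ### Programs over counters -/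

/-- Programs over unary counters indexed by `κ`, with a read-only input tape and a reading head. -/
inductive Cmd (κ : Type)
  | inc (r : κ)
  | dec (r : κ)
  /-- Move the head one symbol to the right, unless it is at the right end. -/
  | next
  /-- Increment `r` if the symbol under the head is `s`. -/
  | test (s : Γ') (r : κ)
  /-- Move the head to the left end. -/
  | rewind
  /-- Move the head to the right end and add the number of symbols passed to `r`. -/
  | scan (r : κ)
  | seq (a b : Cmd κ)
  /-- While `r` is positive, decrement it and run `a`. -/
  | loop (r : κ) (a : Cmd κ)

/-- The memory of a counter program: the symbols left of the head (in reversed order), the symbols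
from the head on, and the counters. -/
structure Mem (κ : Type) where
  left : List Γ'
  right : List Γ'
  ctr : κ → ℕ

/-- The stacks of the Turing machine that executes a counter program. -/
inductive Stack (κ : Type)
  | left
  | right
  | output
  | ctr (r : κ)
  deriving DecidableEq, Fintype

/-- The alphabets of the stacks; a counter is a stack of indistinguishable symbols. -/
abbrev Stack.Symbol {κ : Type} : Stack κ → Type
  | left => Γ'
  | right => Γ'
  | output => Bool
  | ctr _ => Unit

variable {κ : Type}

/-- The stacks that represent a memory. -/
def Mem.stk (m : Mem κ) : (k : Stack κ) → List k.Symbol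
  | .left => m.left
  | .right => m.right
  | .output => []
  | .ctr r => List.replicate (m.ctr r) ()

section stk

variable [DecidableEq κ] (l l' w w' : List Γ') (c : κ → ℕ)

theorem Mem.update_stk_left :
    Function.update (Mem.stk ⟨l, w, c⟩) .left l' = Mem.stk ⟨l', w, c⟩ := by
  funext k
  cases k <;> rfl

theorem Mem.update_stk_right :
    Function.update (Mem.stk ⟨l, w, c⟩) .right w' = Mem.stk ⟨l, w', c⟩ := by
  funext k
  cases k <;> rfl

theorem Mem.update_stk_ctr (r : κ) (n : ℕ) :
    Function.update (Mem.stk ⟨l, w, c⟩) (.ctr r) (List.replicate n ()) =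
      Mem.stk ⟨l, w, Function.update c r n⟩ := by
  funext k
  rcases k with _ | _ | _ | k
  any_goals rfl
  obtain rfl | hk := eq_or_ne k r
  · simp [Mem.stk]
  · simp [Mem.stk, hk]

end stk

namespace Cmd

/-- The labels of the code of a program. -/
def Label : Cmd κ → Type
  | seq a b => a.Label ⊕ b.Label
  | loop _ a => Option a.Label
  | _ => Unit

/-- The label at which the code of a program starts. -/
def entry : (a : Cmd κ) → a.Label
  | inc _ | dec _ | next | test _ _ | rewind | scan _ => ()
  | seq a _ => .inl a.entry
  | loop _ _ => none

instance finite_label : (a : Cmd κ) → Finite a.Label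
  | inc _ | dec _ | next | test _ _ | rewind | scan _ => inferInstanceAs (Finite Unit)
  | seq a b =>
    have := a.finite_label
    have := b.finite_label
    inferInstanceAs (Finite (a.Label ⊕ b.Label))
  | loop _ a =>
    have := a.finite_label
    inferInstanceAs (Finite (Option a.Label))

/-- The code of a program inside a machine with labels `Λ`: its labels are placed by `e`, and it
leaves at the label `x`. The state of the machine holds the symbol read last. -/
def code {Λ : Type} : (a : Cmd κ) → (a.Label → Λ) → Λ → a.Label →
    TM2.Stmt (Stack.Symbol (κ := κ)) Λ (Option Γ')
  | inc r, _, x, _ => .push (.ctr r) (fun _ => ()) (.goto fun _ => x)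
  | dec r, _, x, _ => .pop (.ctr r) (fun v _ => v) (.goto fun _ => x)
  | next, _, x, _ =>
    .pop .right (fun _ s => s) (.branch Option.isSome
      (.push .left (fun v => v.getD .blank) (.goto fun _ => x)) (.goto fun _ => x))
  | test s r, _, x, _ =>
    .peek .right (fun _ s => s) (.branch (· == some s)
      (.push (.ctr r) (fun _ => ()) (.goto fun _ => x)) (.goto fun _ => x))
  | rewind, e, x, _ =>
    .pop .left (fun _ s => s) (.branch Option.isSome
      (.push .right (fun v => v.getD .blank) (.goto fun _ => e ())) (.goto fun _ => x))
  | scan r, e, x, _ =>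
    .pop .right (fun _ s => s) (.branch Option.isSome
      (.push .left (fun v => v.getD .blank)
        (.push (.ctr r) (fun _ => ()) (.goto fun _ => e ()))) (.goto fun _ => x))
  | seq a b, e, x, l => match l with
    | .inl l => a.code (e ∘ .inl) (e (.inr b.entry)) l
    | .inr l => b.code (e ∘ .inr) x l
  | loop r a, e, x, l => match l with
    | none => .pop (.ctr r) (fun _ s => s.map fun _ => .blank) (.branch Option.isSome
        (.goto fun _ => e (some a.entry)) (.goto fun _ => x))
    | some l => a.code (e ∘ some) (e none) l

variable [DecidableEq κ]

/-- The code of `a`, in whatever machine it is placed, transforms the memory `m` into `m'` within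
`T` steps. -/
def Takes (a : Cmd κ) (T : ℕ) (m m' : Mem κ) : Prop :=
  ∀ (Λ : Type) (M : Λ → TM2.Stmt (Stack.Symbol (κ := κ)) Λ (Option Γ')) (e : a.Label → Λ) (x : Λ),
    (∀ l, M (e l) = a.code e x l) → ∀ v, ∃ v', Nonempty
      (EvalsToInTime (TM2.step M) ⟨some (e a.entry), v, m.stk⟩ (some ⟨some x, v', m'.stk⟩) T)

section Takes

variable {a b : Cmd κ} {r : κ} {l w : List Γ'} {c : κ → ℕ} {m m' m'' : Mem κ} {T T' : ℕ}

theorem Takes.mono (h : a.Takes T m m') (hT : T ≤ T') : a.Takes T' m m' := fun Λ M e x hM v =>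
  let ⟨v', ⟨hv'⟩⟩ := h Λ M e x hM v
  ⟨v', ⟨⟨hv'.toEvalsTo, hv'.steps_le_m.trans hT⟩⟩⟩

theorem Takes.of_stepAux (h : ∀ {Λ : Type} (e : a.Label → Λ) (x : Λ) (v : Option Γ'), ∃ v',
    TM2.stepAux (a.code e x a.entry) v m.stk = ⟨some x, v', m'.stk⟩) : a.Takes 1 m m' := by
  intro Λ M e x hM v
  obtain ⟨v', hv'⟩ := h e x v
  refine ⟨v', ⟨⟨1, ?_⟩, le_rfl⟩⟩
  change some (TM2.stepAux (M (e a.entry)) v m.stk) = _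
  rw [hM, hv']

theorem Takes.of_stepAux_entry (h : ∀ {Λ : Type} (e : a.Label → Λ) (x : Λ) (v : Option Γ'), ∃ v',
    TM2.stepAux (a.code e x a.entry) v m.stk = ⟨some (e a.entry), v', m'.stk⟩)
    (h' : a.Takes T m' m'') : a.Takes (T + 1) m m'' := by
  intro Λ M e x hM v
  obtain ⟨v', hv'⟩ := h e x v
  obtain ⟨v'', ⟨hv''⟩⟩ := h' Λ M e x hM v'
  refine ⟨v'', ⟨.trans _ 1 T _ _ _ ⟨⟨1, ?_⟩, le_rfl⟩ hv''⟩⟩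
  change some (TM2.stepAux (M (e a.entry)) v m.stk) = _
  rw [hM, hv']

theorem takes_inc : (inc r).Takes 1 ⟨l, w, c⟩ ⟨l, w, Function.update c r (c r + 1)⟩ :=
  Takes.of_stepAux fun _ x v => ⟨v, by
    rw [← Mem.update_stk_ctr]
    rfl⟩

theorem takes_dec : (dec r).Takes 1 ⟨l, w, c⟩ ⟨l, w, Function.update c r (c r - 1)⟩ :=
  Takes.of_stepAux fun _ x v => ⟨v, by
    rw [← Mem.update_stk_ctr, ← List.tail_replicate]
    rfl⟩

theorem takes_next :
    next.Takes 1 ⟨l, w, c⟩ ⟨(w.take 1).reverse ++ l, w.drop 1, c⟩ := by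
  cases w with
  | nil =>
    refine Takes.of_stepAux fun _ x v => ⟨none, ?_⟩
    nth_rw 2 [← Mem.update_stk_right (w := [])]
    rfl
  | cons s w =>
    refine Takes.of_stepAux fun _ x v => ⟨some s, ?_⟩
    change _ = (⟨_, _, Mem.stk ⟨s :: l, w, c⟩⟩ : TM2.Cfg _ _ _)
    rw [← Mem.update_stk_left l (s :: l) w c, ← Mem.update_stk_right l (s :: w) w c]
    rfl

theorem takes_test (s : Γ') : (test s r).Takes 1 ⟨l, w, c⟩
    ⟨l, w, Function.update c r (c r + if w.head? = some s then 1 else 0)⟩ := by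
  refine Takes.of_stepAux fun _ x v => ⟨w.head?, ?_⟩
  change (bif w.head? == some s then _ else _) = _
  by_cases h : w.head? = some s
  · rw [beq_iff_eq.2 h, if_pos h, ← Mem.update_stk_ctr]
    rfl
  · rw [beq_eq_false_iff_ne.2 h, if_neg h, add_zero, Function.update_eq_self]
    rfl

theorem takes_rewind : rewind.Takes (l.length + 1) ⟨l, w, c⟩ ⟨[], l.reverse ++ w, c⟩ := by
  induction l generalizing w with
  | nil =>
    refine Takes.of_stepAux fun _ x v => ⟨none, ?_⟩
    nth_rw 2 [← Mem.update_stk_left []]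
    rfl
  | cons s l ih =>
    rw [List.reverse_cons, List.append_assoc]
    refine Takes.of_stepAux_entry (fun _ x v => ⟨some s, ?_⟩) ih
    rw [List.singleton_append, ← Mem.update_stk_right l w (s :: w) c,
      ← Mem.update_stk_left (s :: l) l w c]
    rfl

theorem takes_scan : (scan r).Takes (w.length + 1) ⟨l, w, c⟩
    ⟨w.reverse ++ l, [], Function.update c r (c r + w.length)⟩ := by
  induction w generalizing l c with
  | nil =>
    refine Takes.of_stepAux fun _ x v => ⟨none, ?_⟩
    rw [List.length_nil, add_zero, Function.update_eq_self]
    nth_rw 2 [← Mem.update_stk_right (w := [])]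
    rfl
  | cons s w ih =>
    have ih := ih (l := s :: l) (c := Function.update c r (c r + 1))
    rw [Function.update_self, Function.update_idem, add_assoc, add_comm 1] at ih
    rw [List.reverse_cons, List.append_assoc]
    refine Takes.of_stepAux_entry (fun _ x v => ⟨some s, ?_⟩) ih
    rw [← Mem.update_stk_ctr, ← Mem.update_stk_left l (s :: l) w c,
      ← Mem.update_stk_right l (s :: w) w c]
    rfl

theorem Takes.seq (ha : a.Takes T m m') (hb : b.Takes T' m' m'') :
    (a.seq b).Takes (T' + T) m m'' := by
  intro Λ M e x hM v
  obtain ⟨v', ⟨hv'⟩⟩ := ha Λ M (e ∘ .inl) (e (.inr b.entry)) (fun l => hM (.inl l)) v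
  obtain ⟨v'', ⟨hv''⟩⟩ := hb Λ M (e ∘ .inr) x (fun l => hM (.inr l)) v'
  exact ⟨v'', ⟨hv'.trans _ _ _ _ _ _ hv''⟩⟩

theorem takes_loop_of_eq_zero (h : c r = 0) : (loop r a).Takes 1 ⟨l, w, c⟩ ⟨l, w, c⟩ :=
  Takes.of_stepAux fun _ x v => ⟨none, by
    nth_rw 2 [← Function.update_eq_self r c]
    rw [← Mem.update_stk_ctr]
    simp [code, entry, TM2.stepAux, Mem.stk, h]⟩

theorem takes_loop_of_eq_succ {n : ℕ} (h : c r = n + 1)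
    (ha : a.Takes T ⟨l, w, Function.update c r n⟩ m') (hb : (loop r a).Takes T' m' m'') :
    (loop r a).Takes (T' + (T + 1)) ⟨l, w, c⟩ m'' := by
  intro Λ M e x hM v
  obtain ⟨v', ⟨hv'⟩⟩ := ha Λ M (fun l => e (some l)) (e none) (fun l => hM (some l)) (some .blank)
  obtain ⟨v'', ⟨hv''⟩⟩ := hb Λ M e x hM v'
  refine ⟨v'', ⟨.trans _ _ _ _ _ _ (.trans _ 1 _ _ _ _ ⟨⟨1, ?_⟩, le_rfl⟩ hv') hv''⟩⟩
  change some (TM2.stepAux (M (e (loop r a).entry)) v _) = _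
  rw [hM, ← Mem.update_stk_ctr]
  simp [code, entry, TM2.stepAux, Mem.stk, h, List.replicate_succ]

end Takes

/-- The machine that runs `a`, erases its input, and outputs whether the counter `r`, which has to
be at most `1`, is positive. -/
noncomputable def machine [Fintype κ] (a : Cmd κ) (r : κ) : FinTM2 where
  K := Stack κ
  k₀ := .right
  k₁ := .output
  Γ := Stack.Symbol
  Λ := Option a.Label
  main := some a.entry
  ΛFin := Fintype.ofFinite _
  σ := Option Γ'
  initialState := none
  Γk₀Fin := inferInstanceAs (Fintype Γ')
  m
    | some l => a.code some none l
    | none => .pop .right (fun _ s => s) (.branch Option.isSome (.goto fun _ => none)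
        (.pop (.ctr r) (fun _ s => s.map fun _ => .blank)
          (.push .output Option.isSome (.load (fun _ => none) .halt))))

variable [Fintype κ] (a : Cmd κ) (r : κ)

theorem initList_machine (w : List Γ') :
    initList (a.machine r) w = ⟨some (some a.entry), none, Mem.stk ⟨[], w, 0⟩⟩ := by
  unfold initList
  congr 1
  funext k
  cases k <;> rfl

theorem haltList_machine (b : Bool) : haltList (a.machine r) [b] =
    ⟨none, none, Function.update (Mem.stk ⟨[], [], 0⟩) .output [b]⟩ := by
  unfold haltList
  congr 1
  funext k
  cases k <;> rfl

theorem nonempty_evalsToInTime_machine_none {n : ℕ} (hn : n ≤ 1) (w : List Γ') (v : Option Γ') :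
    Nonempty (EvalsToInTime (a.machine r).step
      ⟨some none, v, Mem.stk ⟨[], w, Function.update 0 r n⟩⟩
      (some (haltList (a.machine r) [decide (0 < n)])) (w.length + 1)) := by
  induction w generalizing v with
  | nil =>
    refine ⟨⟨⟨1, ?_⟩, le_rfl⟩⟩
    have hr : Mem.stk ⟨[], [], Function.update 0 r n⟩ (.ctr r) = List.replicate n () := by
      simp [Mem.stk]
    have hright := Mem.update_stk_right [] [] [] (Function.update 0 r n)
    have hctr : Function.update (Mem.stk ⟨[], [], Function.update 0 r n⟩) (.ctr r) [] =
        Mem.stk ⟨[], [], 0⟩ := by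
      refine (Mem.update_stk_ctr [] [] _ r 0).trans ?_
      rw [Function.update_idem]
      exact congrArg (fun c => Mem.stk ⟨[], [], c⟩) (Function.update_eq_self r 0)
    rw [haltList_machine, ← hctr]
    set S := Mem.stk ⟨[], [], Function.update 0 r n⟩
    change some (⟨none, none, Function.update (Function.update (Function.update S .right [])
      (.ctr r) (Function.update S .right [] (.ctr r)).tail) .output
      [((Function.update S .right [] (.ctr r)).head?.map fun _ => Γ'.blank).isSome]⟩ :
      TM2.Cfg (Stack.Symbol (κ := κ)) (Option a.Label) (Option Γ')) = _
    rw [hright, hr]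
    interval_cases n <;> rfl
  | cons s w ih =>
    obtain ⟨ih⟩ := ih (some s)
    refine ⟨.trans _ 1 _ _ _ _ ⟨⟨1, ?_⟩, le_rfl⟩ ih⟩
    rw [← Mem.update_stk_right [] (s :: w) w]
    rfl

end Cmd

theorem DecisionProblem.inP_of_takes {D : DecisionProblem} [Finite κ] [DecidableEq κ] (a : Cmd κ)
    (r : κ) (p : Polynomial ℕ) (f : D.Inst → ℕ) (hf : ∀ I, f I ≤ 1) (hD : ∀ I, 0 < f I ↔ D.Yes I)
    (ha : ∀ I, a.Takes (p.eval (D.encode I).length) ⟨[], D.encode I, 0⟩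
      ⟨[], D.encode I, Function.update 0 r (f I)⟩) : D.InP := by
  classical
  have := Fintype.ofFinite κ
  refine ⟨{ tm := a.machine r, inputAlphabet := Equiv.refl Γ', outputAlphabet := Equiv.refl Bool,
            time := Polynomial.X + 1 + p, outputsFun := fun I => Classical.choice ?_ }⟩
  obtain ⟨v, ⟨hv⟩⟩ := ha I _ (a.machine r).m some none (fun _ => rfl) none
  obtain ⟨hw⟩ := a.nonempty_evalsToInTime_machine_none r (hf I) (D.encode I) v
  simp only [hD] at hw
  rw [Polynomial.eval_add, Polynomial.eval_add, Polynomial.eval_X, Polynomial.eval_one]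
  change Nonempty (EvalsToInTime _ (initList (a.machine r) ((D.encode I).map id))
    (some (haltList (a.machine r) [decide (D.Yes I)])) _)
  rw [show initList (a.machine r) ((D.encode I).map id) = _ from
    (congrArg _ (List.map_id _)).trans (a.initList_machine r _)]
  exact ⟨hv.trans _ _ _ _ _ _ hw⟩

/-- The counters `0, …, N - 1` hold a stack, given from its top down to its bottom in the counter
`0`. Counters above the top are `0`. -/
def counters (N : ℕ) (L : List ℕ) : Fin N → ℕ := fun r => L.reverse.getD r 0

section counters

variable {N : ℕ}

theorem counters_nil : counters N [] = 0 := rfl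

theorem counters_zero_cons (L : List ℕ) : counters N (0 :: L) = counters N L := by
  funext r
  simp only [counters, List.reverse_cons]
  grind

variable (U L : List ℕ) (k l : ℕ) {r : Fin N} (hr : (r : ℕ) = L.length)
include hr

theorem counters_apply : counters N (U ++ k :: L) r = k := by
  simp [counters, hr]

theorem update_counters :
    Function.update (counters N (U ++ k :: L)) r l = counters N (U ++ l :: L) := by
  funext q
  obtain rfl | hq := eq_or_ne q r
  · simp [counters, hr]
  · rw [Function.update_of_ne hq]
    simp only [counters, List.reverse_append, List.reverse_cons]
    have : (q : ℕ) ≠ L.length := hr ▸ Fin.val_ne_of_ne hq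
    grind

end counters

namespace Cmd

variable {κ : Type} [DecidableEq κ] in
theorem takes_loop {a : Cmd κ} {r : κ} {T : ℕ} (n : ℕ) (m : ℕ → Mem κ)
    (hm : ∀ i ≤ n, (m i).ctr r = n - i)
    (ha : ∀ i < n, a.Takes T ⟨(m i).left, (m i).right, Function.update (m i).ctr r (n - i - 1)⟩
      (m (i + 1))) :
    (loop r a).Takes (n * (T + 1) + 1) (m 0) (m n) := by
  induction n generalizing m with
  | zero => exact (takes_loop_of_eq_zero (hm 0 le_rfl)).mono (by omega)
  | succ n ih =>
    have h := ih (fun i => m (i + 1)) (fun i hi => by rw [hm _ (by omega)]; omega) fun i hi => by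
      have := ha (i + 1) (by omega)
      rwa [Nat.add_sub_add_right] at this
    exact (takes_loop_of_eq_succ (hm 0 (by omega)) (ha 0 (by omega)) h).mono (by grind)

/-- On the input `w`, the program `a` transforms the stack `L` of counters into the stack `L'`
within `T` steps. -/
def Runs {N : ℕ} (a : Cmd (Fin N)) (w : List Γ') (T : ℕ) (L L' : List ℕ) : Prop :=
  a.Takes T ⟨[], w, counters N L⟩ ⟨[], w, counters N L'⟩

variable {N : ℕ} {a b : Cmd (Fin N)} {w : List Γ'} {T T' : ℕ} {L L' L'' : List ℕ} {r s : Fin N}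

theorem Runs.mono (h : a.Runs w T L L') (hT : T ≤ T') : a.Runs w T' L L' :=
  Takes.mono h hT

theorem Runs.seq (ha : a.Runs w T L L') (hb : b.Runs w T' L' L'') :
    (a.seq b).Runs w (T' + T) L L'' :=
  Takes.seq ha hb

theorem runs_cons_zero : a.Runs w T L (0 :: L') ↔ a.Runs w T L L' := by
  rw [Runs, counters_zero_cons, Runs]

theorem zero_cons_runs : a.Runs w T (0 :: L) L' ↔ a.Runs w T L L' := by
  rw [Runs, counters_zero_cons, Runs]

theorem runs_rewind : (rewind : Cmd (Fin N)).Runs w 1 L L :=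
  takes_rewind

theorem runs_inc (U : List ℕ) (k : ℕ) (hr : (r : ℕ) = L.length) :
    (inc r).Runs w 1 (U ++ k :: L) (U ++ (k + 1) :: L) := by
  have h := takes_inc (r := r) (l := []) (w := w) (c := counters N (U ++ k :: L))
  rwa [counters_apply _ _ _ hr, update_counters _ _ _ _ hr] at h

theorem runs_dec (U : List ℕ) (k : ℕ) (hr : (r : ℕ) = L.length) :
    (dec r).Runs w 1 (U ++ k :: L) (U ++ (k - 1) :: L) := by
  have h := takes_dec (r := r) (l := []) (w := w) (c := counters N (U ++ k :: L))
  rwa [counters_apply _ _ _ hr, update_counters _ _ _ _ hr] at h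

theorem runs_loop (n : ℕ) (U V : ℕ → List ℕ) (hV : ∀ i ≤ n, (r : ℕ) = (V i).length)
    (ha : ∀ i < n, a.Runs w T (U i ++ (n - i - 1) :: V i) (U (i + 1) ++ (n - i - 1) :: V (i + 1))) :
    (loop r a).Runs w (n * (T + 1) + 1) (U 0 ++ n :: V 0) (U n ++ 0 :: V n) := by
  have h := takes_loop n (fun i => ⟨[], w, counters N (U i ++ (n - i) :: V i)⟩)
    (fun i hi => counters_apply _ _ _ (hV i hi)) fun i hi => by
      dsimp only
      rw [update_counters _ _ _ _ (hV i hi.le)]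
      exact ha i hi
  simp only [Nat.sub_self, Nat.sub_zero] at h
  exact h

/-- Set the counter `r` to `0`. -/
def clear (r : Fin N) : Cmd (Fin N) := loop r rewind

theorem runs_clear (U : List ℕ) (k : ℕ) (hr : (r : ℕ) = L.length) :
    (clear r).Runs w (k * 2 + 1) (U ++ k :: L) (U ++ 0 :: L) :=
  runs_loop k (fun _ => U) (fun _ => L) (fun _ _ => hr) fun _ _ => runs_rewind

/-- Add the counter `r` to the counter `s`, and set `r` to `0`. -/
def move (r s : Fin N) : Cmd (Fin N) := loop r (inc s)

theorem runs_move (U V : List ℕ) (k l : ℕ) (hr : (r : ℕ) = (V ++ l :: L).length)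
    (hs : (s : ℕ) = L.length) :
    (move r s).Runs w (k * 2 + 1) (U ++ k :: (V ++ l :: L)) (U ++ 0 :: (V ++ (l + k) :: L)) := by
  refine runs_loop k (fun _ => U) (fun i => V ++ (l + i) :: L) (fun _ _ => by simp [hr])
    fun i _ => ?_
  have h := runs_inc (r := s) (w := w) (U ++ (k - i - 1) :: V) (l + i) hs
  simp only [List.append_assoc, List.cons_append] at h
  exact h

/-- Add the counter `r` to the counters `s` and `t`, and set `r` to `0`. -/
def distribute (r s t : Fin N) : Cmd (Fin N) := loop r ((inc s).seq (inc t))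

theorem runs_distribute (U : List ℕ) (k : ℕ) (hr : (r : ℕ) = L.length)
    {s t : Fin N} (hs : (s : ℕ) = U.length + L.length + 1) (ht : (t : ℕ) = s + 1) :
    (distribute r s t).Runs w (k * 3 + 1) (0 :: 0 :: (U ++ k :: L))
      (k :: k :: (U ++ 0 :: L)) := by
  refine runs_loop k (fun i => i :: i :: U) (fun _ => L) (fun _ _ => hr) fun i _ => ?_
  have hs' : (s : ℕ) = (U ++ (k - i - 1) :: L).length := by simp [hs]; omega
  exact (runs_inc (r := s) (w := w) [i] i hs').seq
    (runs_inc (r := t) (w := w) [] i (by simp [ht, hs']))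

/-- Replace the counter `r` by `1` or `0`, according to whether its value is a position of the
symbol `s` in the input. -/
def lookup (s : Γ') (r : Fin N) : Cmd (Fin N) := (loop r next).seq ((test s r).seq rewind)

theorem runs_lookup (s : Γ') (n : ℕ) (hr : (r : ℕ) = L.length) :
    (lookup s r).Runs w (w.length + n * 2 + 3) (n :: L)
      ((if w[n]? = some s then 1 else 0) :: L) := by
  have hnext : (loop r next).Takes (n * 2 + 1) ⟨[], w, counters N (n :: L)⟩
      ⟨(w.take n).reverse, w.drop n, counters N ([] ++ 0 :: L)⟩ := by
    have h := takes_loop (a := next) n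
      (fun i => ⟨(w.take i).reverse, w.drop i, counters N ([] ++ (n - i) :: L)⟩)
      (fun i _ => counters_apply _ _ _ hr) (T := 1) fun i _ => by
        rw [List.take_add, List.reverse_append, ← List.drop_drop]
        dsimp only
        rw [update_counters _ _ _ _ hr]
        exact takes_next
    rwa [Nat.sub_self] at h
  have htest := takes_test (r := r) (l := (w.take n).reverse) (w := w.drop n)
    (c := counters N ([] ++ 0 :: L)) s
  rw [counters_apply _ _ _ hr, update_counters _ _ _ _ hr, List.head?_drop, zero_add] at htest
  have hrewind := takes_rewind (l := (w.take n).reverse) (w := w.drop n)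
    (c := counters N ([] ++ (if w[n]? = some s then 1 else 0) :: L))
  rw [List.reverse_reverse, List.take_append_drop, List.length_reverse, List.length_take] at hrewind
  exact (hnext.seq (htest.seq hrewind)).mono (by omega)

/-- Replace `val` repeatedly by the number that `a` leaves in `new`, while `rem` is counted down and
`idx` is counted up. -/
def iterate (val idx rem new : Fin N) (a : Cmd (Fin N)) : Cmd (Fin N) :=
  (loop rem (((a.seq (clear val)).seq (move new val)).seq (inc idx))).seq (clear idx)

theorem runs_iterate {val idx rem new : Fin N} (hval : (val : ℕ) = L.length)
    (hidx : (idx : ℕ) = L.length + 1) (hrem : (rem : ℕ) = L.length + 2)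
    (hnew : (new : ℕ) = L.length + 3) (n B : ℕ) (F : ℕ → ℕ) (hF : ∀ i ≤ n, F i ≤ B)
    (ha : ∀ i < n, ∀ k, a.Runs w T (k :: i :: F i :: L) (F (i + 1) :: k :: i :: F i :: L)) :
    (iterate val idx rem new a).Runs w (n * 2 + 1 + (n * (B * 4 + T + 4) + 1))
      (n :: 0 :: F 0 :: L) (F n :: L) := by
  have hloop : (loop rem (((a.seq (clear val)).seq (move new val)).seq (inc idx))).Runs w
      (n * (B * 4 + T + 3 + 1) + 1) (n :: 0 :: F 0 :: L) (0 :: n :: F n :: L) := by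
    refine runs_loop n (fun _ => []) (fun i => i :: F i :: L) (fun i _ => by simp [hrem])
      fun i hi => ?_
    have hclear := runs_clear (w := w) (r := val) [F (i + 1), n - i - 1, i] (F i) hval
    have hmove := runs_move (w := w) (r := new) (s := val) [] [n - i - 1, i] (F (i + 1)) 0
      (by simp [hnew]) hval
    have hinc := runs_inc (w := w) (r := idx) [n - i - 1] i (L := F (i + 1) :: L) (by simp [hidx])
    have hB := hF i hi.le
    have hB' := hF (i + 1) hi
    rw [zero_add] at hmove
    exact ((((ha i hi _).seq hclear).seq hmove).seq (zero_cons_runs.2 hinc)).mono (by omega)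
  have hclear := runs_clear (w := w) (r := idx) [0] n (L := F n :: L) (by simp [hidx])
  exact runs_cons_zero.1 (runs_cons_zero.1 (hloop.seq hclear))

end Cmd

end Machine

section PolyTime

open Turing Computability

/-! ### Functions computable in polynomial time -/

/-- An element of a context is an input word together with the values of some variables, the
variable introduced last being listed first. -/
class Context (X : Type) where
  word : X → List Γ'
  vars : X → List ℕ

open Context Cmd

instance (D : DecisionProblem) : Context D.Inst where
  word := D.encode
  vars _ := []

section Context

variable {X Y : Type} [Context X] [Context Y]

instance : Context (X × ℕ) where
  word x := word x.1
  vars x := x.2 :: vars x.1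

instance (n : X → ℕ) : Context ((x : X) × Fin (n x)) where
  word x := word x.1
  vars x := x.2 :: vars x.1

/-- The length of the input, with the variables written in unary. -/
def size (x : X) : ℕ := (word x).length + (vars x).sum

theorem size_prod (x : X × ℕ) : size x = size x.1 + x.2 := by
  simp only [size, vars, word, List.sum_cons]
  ring

theorem size_sigma {n : X → ℕ} (x : (x : X) × Fin (n x)) : size x = size x.1 + x.2 := by
  simp only [size, vars, word, List.sum_cons]
  ring

end Context

theorem eval_natPolynomial_mono (p : Polynomial ℕ) : Monotone fun k : ℕ => p.eval k := by
  intro k l h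
  simp only [Polynomial.eval_eq_sum_range]
  gcongr

/-- The values of `f` are at most polynomial in the size. -/
def PolyBounded {X : Type} [Context X] (f : X → ℕ) : Prop :=
  ∃ p : Polynomial ℕ, ∀ x, f x ≤ p.eval (size x)

namespace PolyBounded

variable {X Y : Type} [Context X] [Context Y] {f g : X → ℕ}

theorem mono (hg : PolyBounded g) (h : ∀ x, f x ≤ g x) : PolyBounded f :=
  let ⟨p, hp⟩ := hg
  ⟨p, fun x => (h x).trans (hp x)⟩

theorem const (k : ℕ) : PolyBounded fun _ : X => k :=
  ⟨.C k, fun _ => by rw [Polynomial.eval_C]⟩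

theorem size : PolyBounded (size : X → ℕ) :=
  ⟨.X, fun _ => by rw [Polynomial.eval_X]⟩

theorem length_word : PolyBounded fun x : X => (word x).length :=
  PolyBounded.size.mono fun _ => Nat.le_add_right _ _

theorem add (hf : PolyBounded f) (hg : PolyBounded g) : PolyBounded fun x => f x + g x :=
  let ⟨p, hp⟩ := hf
  let ⟨q, hq⟩ := hg
  ⟨p + q, fun x => by rw [Polynomial.eval_add]; exact add_le_add (hp x) (hq x)⟩

theorem mul (hf : PolyBounded f) (hg : PolyBounded g) : PolyBounded fun x => f x * g x :=
  let ⟨p, hp⟩ := hf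
  let ⟨q, hq⟩ := hg
  ⟨p * q, fun x => by rw [Polynomial.eval_mul]; exact Nat.mul_le_mul (hp x) (hq x)⟩

theorem eval (p : Polynomial ℕ) (hf : PolyBounded f) : PolyBounded fun x => p.eval (f x) :=
  let ⟨q, hq⟩ := hf
  ⟨p.comp q, fun x => by
    rw [Polynomial.eval_comp]
    exact eval_natPolynomial_mono p (hq x)⟩

theorem exists_forall_le {f : Y → ℕ} (hf : PolyBounded f) (hg : PolyBounded g) :
    ∃ B : X → ℕ, PolyBounded B ∧ ∀ x y, Manip.size y ≤ g x → f y ≤ B x :=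
  let ⟨p, hp⟩ := hf
  ⟨_, hg.eval p, fun _ y h => (hp y).trans (eval_natPolynomial_mono p h)⟩

theorem comp (hf : PolyBounded f) {u : Y → X} (hu : PolyBounded fun y => Manip.size (u y)) :
    PolyBounded fun y => f (u y) :=
  let ⟨p, hp⟩ := hf
  (hu.eval p).mono fun y => hp (u y)

end PolyBounded

section Holds

/-- In the stack `L`, the counters `ρ` have the values `v`. -/
def Holds (ρ L v : List ℕ) : Prop :=
  ρ.map (fun r => L.reverse.getD r 0) = v

variable {ρ L v : List ℕ}

theorem Holds.append_left (h : Holds ρ L v) (hρ : ∀ r ∈ ρ, r < L.length) (U : List ℕ) :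
    Holds ρ (U ++ L) v := by
  rw [← show _ = v from h]
  refine List.map_congr_left fun r hr => ?_
  rw [List.reverse_append, List.getD_append _ _ _ _ (by simpa using hρ r hr)]

theorem Holds.cons (h : Holds ρ L v) {b : ℕ} (hb : L.length = b) (hρ : ∀ r ∈ ρ, r < b) (k : ℕ) :
    Holds (b :: ρ) (k :: L) (k :: v) := by
  rw [Holds, List.map_cons]
  congr 1
  · simp [← hb]
  · exact h.append_left (hb ▸ hρ) [k]

theorem Holds.drop (h : Holds ρ L v) (j : ℕ) : Holds (ρ.drop j) L (v.drop j) := by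
  rw [Holds, List.map_drop, show _ = v from h]

theorem exists_eq_append_cons_of_lt_length {r : ℕ} (h : r < L.length) :
    ∃ U V, V.length = r ∧ L = U ++ L.reverse.getD r 0 :: V := by
  refine ⟨L.take (L.length - 1 - r), L.drop (L.length - r), by simp; omega, ?_⟩
  have : L.length - 1 - r < L.length := by omega
  rw [List.getD_eq_getElem _ _ (by simpa), List.getElem_reverse]
  have : L.length - r = L.length - 1 - r + 1 := by omega
  rw [this, ← List.drop_eq_getElem_cons, List.take_append_drop]

end Holds

/-- `f` is computed in polynomial time by a counter program, which leaves its value on top of the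
stack of counters, uses at most `k` counters above the stack, and can be placed on top of every
stack that holds the variables. The values of `f` are required to be polynomially bounded, so that
they can be used as numbers of iterations. -/
def PolyTimeFun {X : Type} [Context X] (f : X → ℕ) : Prop :=
  PolyBounded f ∧ ∃ (k : ℕ) (T : X → ℕ), PolyBounded T ∧
    ∀ (N b : ℕ) (ρ : List ℕ), (∀ r ∈ ρ, r < b) → b + k ≤ N → ∃ a : Cmd (Fin N),
      ∀ (x : X) (L : List ℕ), L.length = b → Holds ρ L (vars x) → a.Runs (word x) (T x) L (f x :: L)

namespace PolyTimeFun

variable {X Y : Type} [Context X] [Context Y] {f g : X → ℕ}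

theorem congr (hf : PolyTimeFun f) (h : ∀ x, f x = g x) : PolyTimeFun g :=
  funext h ▸ hf

/-! ### Variables -/

theorem of_head?_vars (h : ∀ x, (vars x).head? = some (f x)) : PolyTimeFun f := by
  have hf : PolyBounded f := PolyBounded.size.mono fun x =>
    (List.le_sum_of_mem (List.mem_of_head? (h x))).trans (Nat.le_add_left _ _)
  refine ⟨hf, 2, _, ((hf.mul (.const 2)).add (.const 1)).add ((hf.mul (.const 3)).add (.const 1)),
    fun N b ρ hρ hN => ?_⟩
  cases ρ with
  | nil => exact ⟨rewind, fun x _ _ hx => by simpa [← show [] = vars x from hx] using h x⟩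
  | cons r ρ =>
    have hr := hρ r List.mem_cons_self
    let r' : Fin N := ⟨r, by omega⟩
    let s : Fin N := ⟨b, by omega⟩
    let t : Fin N := ⟨b + 1, by omega⟩
    refine ⟨(distribute r' s t).seq (move t r'), fun x L hL hx => ?_⟩
    obtain ⟨U, V, hV, hUV⟩ := exists_eq_append_cons_of_lt_length (hL ▸ hr)
    have hfx : L.reverse.getD r 0 = f x := by
      have := h x
      rwa [← show _ = vars x from hx, List.map_cons, List.head?_cons, Option.some_inj] at this
    rw [hfx] at hUV
    have hb : b = U.length + V.length + 1 := by simp [← hL, hUV]; omega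
    have hcopy := runs_distribute (w := word x) (r := r') (s := s) (t := t) U (f x) hV.symm hb rfl
    have hmove := runs_move (w := word x) (r := t) (s := r') [] (f x :: U) (f x) 0 (L := V)
      (by simp [t, hb]; omega) hV.symm
    simp only [zero_add, List.nil_append, List.cons_append, ← hUV] at hcopy hmove
    have h := hcopy.seq hmove
    rwa [runs_cons_zero, zero_cons_runs, zero_cons_runs] at h

theorem comp_drop (hf : PolyTimeFun f) {u : Y → X} (hword : ∀ y, word (u y) = word y) {j : ℕ}
    (hvars : ∀ y, vars (u y) = (vars y).drop j) : PolyTimeFun fun y => f (u y) := by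
  obtain ⟨hf, k, T, hT, h⟩ := hf
  have hu : PolyBounded fun y => size (u y) := PolyBounded.size.mono fun y => by
    rw [size, size, hword, hvars]
    exact Nat.add_le_add_left ((List.drop_sublist _ _).sum_le_sum (by simp)) _
  refine ⟨hf.comp hu, k, _, hT.comp hu, fun N b ρ hρ hN => ?_⟩
  obtain ⟨a, ha⟩ := h N b (ρ.drop j) (fun r hr => hρ r (List.mem_of_mem_drop hr)) hN
  refine ⟨a, fun y L hL hy => hword y ▸ ha (u y) L hL (hvars y ▸ hy.drop j)⟩

theorem comp_cons_drop {f : Y → ℕ} (hf : PolyTimeFun f) (hg : PolyTimeFun g) {u : X → Y}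
    (hword : ∀ x, word (u x) = word x) {j : ℕ} (hvars : ∀ x, vars (u x) = g x :: (vars x).drop j) :
    PolyTimeFun fun x => f (u x) := by
  obtain ⟨hf, k, T, hT, h⟩ := hf
  obtain ⟨hg, l, S, hS, h'⟩ := hg
  have hu : PolyBounded fun x => size (u x) := (PolyBounded.size.add hg).mono fun x => by
    have := (List.drop_sublist j (vars x)).sum_le_sum (by simp)
    rw [size, size, hword, hvars, List.sum_cons]
    omega
  refine ⟨hf.comp hu, k + l + 2, _, (((hf.comp hu).mul (.const 2)).add (.const 1)).add
    (((hg.mul (.const 2)).add (.const 1)).add ((hT.comp hu).add hS)), fun N b ρ hρ hN => ?_⟩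
  have hρj : ∀ r ∈ ρ.drop j, r < b := fun r hr => hρ r (List.mem_of_mem_drop hr)
  obtain ⟨a', ha'⟩ := h' N b ρ hρ (by omega)
  obtain ⟨a, ha⟩ := h N (b + 1) (b :: ρ.drop j)
    (List.forall_mem_cons.2 ⟨by omega, fun r hr => (hρj r hr).trans b.lt_succ_self⟩) (by omega)
  let r : Fin N := ⟨b, by omega⟩
  let s : Fin N := ⟨b + 1, by omega⟩
  refine ⟨((a'.seq a).seq (clear r)).seq (move s r), fun x L hL hx => ?_⟩
  have hrun := ha (u x) (g x :: L) (by simp [hL]) (hvars x ▸ (hx.drop j).cons hL hρj _)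
  rw [hword] at hrun
  have h := (((ha' x L hL hx).seq hrun).seq (runs_clear (r := r) [f (u x)] (g x) hL.symm)).seq
    (runs_move (r := s) (s := r) [] [] (f (u x)) 0 (by simp [s, hL]) hL.symm)
  rwa [zero_add, List.nil_append, List.nil_append, runs_cons_zero] at h

theorem snd : PolyTimeFun fun x : X × ℕ => x.2 :=
  of_head?_vars fun _ => rfl

theorem snd_fin {n : X → ℕ} : PolyTimeFun fun x : (x : X) × Fin (n x) => (x.2 : ℕ) :=
  of_head?_vars fun _ => rfl

theorem comp_fst (hf : PolyTimeFun f) : PolyTimeFun fun x : X × ℕ => f x.1 :=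
  hf.comp_drop (j := 1) (fun _ => rfl) fun _ => rfl

theorem comp_fst_fin (hf : PolyTimeFun f) {n : X → ℕ} :
    PolyTimeFun fun x : (x : X) × Fin (n x) => f x.1 :=
  hf.comp_drop (j := 1) (fun _ => rfl) fun _ => rfl

/-! ### Arithmetic -/

theorem zero : PolyTimeFun fun _ : X => 0 :=
  ⟨.const 0, 0, _, .const 1, fun _ _ _ _ _ =>
    ⟨rewind, fun _ _ _ _ => runs_cons_zero.2 runs_rewind⟩⟩

theorem succ (hf : PolyTimeFun f) : PolyTimeFun fun x => f x + 1 := by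
  obtain ⟨hf, k, T, hT, h⟩ := hf
  refine ⟨hf.add (.const 1), k + 1, _, (PolyBounded.const 1).add hT, fun N b ρ hρ hN => ?_⟩
  obtain ⟨a, ha⟩ := h N b ρ hρ (by omega)
  let r : Fin N := ⟨b, by omega⟩
  exact ⟨a.seq (inc r), fun x L hL hx => (ha x L hL hx).seq (runs_inc (r := r) [] (f x) hL.symm)⟩

theorem const (k : ℕ) : PolyTimeFun fun _ : X => k := by
  induction k with
  | zero => exact zero
  | succ k ih => exact ih.succ

theorem length_word : PolyTimeFun fun x : X => (word x).length := by
  refine ⟨.length_word, 1, _,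
    (PolyBounded.length_word.add (.const 1)).add (PolyBounded.length_word.add (.const 1)),
    fun N b ρ _ hN => ?_⟩
  let r : Fin N := ⟨b, by omega⟩
  refine ⟨(scan r).seq rewind, fun x L hL _ => ?_⟩
  have hscan := takes_scan (r := r) (l := []) (w := word x) (c := counters N ([] ++ 0 :: L))
  rw [counters_apply _ _ _ hL.symm, update_counters _ _ _ _ hL.symm, zero_add, List.append_nil]
    at hscan
  have h := hscan.seq takes_rewind
  rw [List.reverse_reverse, List.append_nil, List.length_reverse] at h
  exact zero_cons_runs.1 h

theorem binary (hf : PolyTimeFun f) (hg : PolyTimeFun g) {op : ℕ → ℕ → ℕ}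
    (hop : ∀ k l, op k l ≤ k + l) (c : ∀ {N}, Fin N → Fin N → Cmd (Fin N))
    (hc : ∀ {N : ℕ} {r s : Fin N} (w : List Γ') (k l : ℕ) (L : List ℕ), (r : ℕ) = L.length →
      (s : ℕ) = L.length + 1 → (c r s).Runs w (l * 2 + 1) (l :: k :: L) (op k l :: L)) :
    PolyTimeFun fun x => op (f x) (g x) := by
  obtain ⟨hf, k, T, hT, h⟩ := hf
  obtain ⟨hg, l, S, hS, h'⟩ := hg
  refine ⟨(hf.add hg).mono fun x => hop _ _, k + l + 2, _,
    ((hg.mul (.const 2)).add (.const 1)).add (hS.add hT), fun N b ρ hρ hN => ?_⟩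
  obtain ⟨a, ha⟩ := h N b ρ hρ (by omega)
  obtain ⟨a', ha'⟩ := h' N (b + 1) ρ (fun r hr => (hρ r hr).trans b.lt_succ_self) (by omega)
  let r : Fin N := ⟨b, by omega⟩
  let s : Fin N := ⟨b + 1, by omega⟩
  refine ⟨(a.seq a').seq (c r s), fun x L hL hx => ?_⟩
  exact ((ha x L hL hx).seq (ha' x (f x :: L) (by simp [hL])
    (hx.append_left (hL ▸ hρ) [f x]))).seq (hc _ _ _ _ hL.symm (by simp [s, hL]))

theorem add (hf : PolyTimeFun f) (hg : PolyTimeFun g) : PolyTimeFun fun x => f x + g x :=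
  hf.binary hg (op := (· + ·)) (fun _ _ => le_rfl) (fun r s => move s r) fun _ k l _ hr hs =>
    runs_cons_zero.1 (runs_move [] [] l k hs hr)

theorem tsub (hf : PolyTimeFun f) (hg : PolyTimeFun g) : PolyTimeFun fun x => f x - g x :=
  hf.binary hg (op := (· - ·)) (fun k l => by omega) (fun r s => loop s (dec r))
    fun w k l L hr hs => runs_cons_zero.1 <|
      runs_loop l (fun _ => []) (fun i => (k - i) :: L) (fun _ _ => hs) fun i _ => by
        have h := runs_dec (w := w) [l - i - 1] (k - i) hr
        rwa [Nat.sub_sub] at h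

theorem min (hf : PolyTimeFun f) (hg : PolyTimeFun g) : PolyTimeFun fun x => min (f x) (g x) :=
  (hf.tsub (hf.tsub hg)).congr fun x => by omega

/-! ### Symbols of the input -/

theorem ite_getElem?_word_snd (s : Γ') :
    PolyTimeFun fun x : X × ℕ => if (word x)[x.2]? = some s then 1 else 0 := by
  obtain ⟨hsnd, k, T, hT, h⟩ := snd (X := X)
  refine ⟨(PolyBounded.const 1).mono fun x => by split_ifs <;> simp, k + 1, _,
    ((PolyBounded.length_word.add (hsnd.mul (.const 2))).add (.const 3)).add hT,
    fun N b ρ hρ hN => ?_⟩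
  obtain ⟨a, ha⟩ := h N b ρ hρ (by omega)
  let r : Fin N := ⟨b, by omega⟩
  exact ⟨a.seq (lookup s r), fun x L hL hx =>
    (ha x L hL hx).seq (runs_lookup (r := r) s x.2 hL.symm)⟩

theorem ite_getElem?_word (hf : PolyTimeFun f) (s : Γ') :
    PolyTimeFun fun x => if (word x)[f x]? = some s then 1 else 0 :=
  (ite_getElem?_word_snd s).comp_cons_drop hf (u := fun x => (x, f x)) (j := 0) (fun _ => rfl)
    fun _ => rfl

/-! ### Iteration -/

theorem iterate {n : X → ℕ} (hn : PolyTimeFun n) {F : X → ℕ → ℕ} {B : X → ℕ} (hB : PolyBounded B)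
    (hF : ∀ x, ∀ i ≤ n x, F x i ≤ B x) (hzero : PolyTimeFun fun x => F x 0)
    {s : ((x : X) × Fin (n x)) × ℕ → ℕ} (hs : PolyTimeFun s)
    (hsucc : ∀ x (i : Fin (n x)), F x (i + 1) = s (⟨x, i⟩, F x i)) :
    PolyTimeFun fun x => F x (n x) := by
  obtain ⟨hn, k, T, hT, h⟩ := hn
  obtain ⟨-, k₀, T₀, hT₀, h₀⟩ := hzero
  obtain ⟨-, l, S, hS, h'⟩ := hs
  obtain ⟨S', hS', hle⟩ := hS.exists_forall_le ((PolyBounded.size.add hn).add hB)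
  refine ⟨hB.mono fun x => hF x _ le_rfl, k₀ + k + l + 4, _,
    (((hn.mul (.const 2)).add (.const 1)).add ((hn.mul (((hB.mul (.const 4)).add hS').add
      (.const 4))).add (.const 1))).add (hT.add hT₀), fun N b ρ hρ hN => ?_⟩
  have hρ' (c : ℕ) : ∀ r ∈ ρ, r < b + c := fun r hr => Nat.lt_add_right c (hρ r hr)
  obtain ⟨a₀, ha₀⟩ := h₀ N b ρ hρ (by omega)
  obtain ⟨a, ha⟩ := h N (b + 2) ρ (hρ' 2) (by omega)
  obtain ⟨a', ha'⟩ := h' N (b + 3) (b :: (b + 1) :: ρ) (by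
    simp only [List.forall_mem_cons]
    exact ⟨by omega, by omega, hρ' 3⟩) (by omega)
  refine ⟨(a₀.seq a).seq (Cmd.iterate ⟨b, by omega⟩ ⟨b + 1, by omega⟩ ⟨b + 2, by omega⟩
    ⟨b + 3, by omega⟩ a'), fun x L hL hx => ?_⟩
  have hcount := ha x (0 :: F x 0 :: L) (by simp [hL]) (hx.append_left (hL ▸ hρ) [_, _])
  refine ((ha₀ x L hL hx).seq (zero_cons_runs.1 hcount)).seq (runs_iterate (by simp [hL])
    (by simp [hL]) (by simp [hL]) (by simp [hL]) (n x) (B x) (F x) (hF x) fun i hi v => ?_)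
  have hvars : Holds (b :: (b + 1) :: ρ) (v :: i :: F x i :: L) (F x i :: i :: vars x) := by
    have hx' : Holds ρ (v :: i :: F x i :: L) (vars x) := hx.append_left (hL ▸ hρ) [v, i, F x i]
    rw [Holds, List.map_cons, List.map_cons, show _ = vars x from hx']
    simp [← hL]
  have hrun := ha' (⟨x, i, hi⟩, F x i) (v :: i :: F x i :: L) (by simp [hL]) hvars
  rw [← hsucc x ⟨i, hi⟩] at hrun
  refine hrun.mono (hle x _ ?_)
  rw [size_prod, size_sigma]
  exact Nat.add_le_add (Nat.add_le_add_left hi.le _) (hF x i hi.le)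

theorem sum {n : X → ℕ} (hn : PolyTimeFun n) {f : (x : X) × Fin (n x) → ℕ} (hf : PolyTimeFun f) :
    PolyTimeFun fun x => ∑ i, f ⟨x, i⟩ := by
  let F (x : X) (p : ℕ) : ℕ := ∑ i with i.val < p, f ⟨x, i⟩
  obtain ⟨B, hB, hle⟩ := hf.1.exists_forall_le (PolyBounded.size.add hn.1)
  refine (iterate hn (hn.1.mul hB) (F := F) (fun x p _ => ?_) (zero.congr fun x => by simp [F])
    (s := fun y => y.2 + f y.1) (snd.add hf.comp_fst) fun x i => ?_).congr fun x => by simp [F]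
  · calc F x p ≤ ∑ i, f ⟨x, i⟩ := Finset.sum_le_sum_of_subset (Finset.filter_subset _ _)
      _ ≤ n x * B x := by
        simpa using Finset.sum_le_card_nsmul Finset.univ _ _ fun i _ =>
          hle x ⟨x, i⟩ (by rw [size_sigma]; exact Nat.add_le_add_left i.is_lt.le _)
  · have : (Finset.univ.filter fun j : Fin (n x) => (j : ℕ) < i + 1)
        = insert i (Finset.univ.filter fun j : Fin (n x) => j.val < i.val) := by
      ext j
      simp [Fin.ext_iff]
      omega
    simp only [F, this]
    rw [Finset.sum_insert (by simp), add_comm]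

theorem mul (hf : PolyTimeFun f) (hg : PolyTimeFun g) : PolyTimeFun fun x => f x * g x :=
  (sum hf hg.comp_fst_fin).congr fun x => by simp

end PolyTimeFun

/-- The predicate `P` is decided in polynomial time by a counter program, whose result is positive
if and only if `P` holds. -/
def PolyTimePred {X : Type} [Context X] (P : X → Prop) : Prop :=
  ∃ f, PolyTimeFun f ∧ ∀ x, 0 < f x ↔ P x

namespace PolyTimePred

variable {X : Type} [Context X] {f g : X → ℕ} {P Q : X → Prop}

theorem congr (hP : PolyTimePred P) (h : ∀ x, P x ↔ Q x) : PolyTimePred Q := by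
  rwa [← funext fun x => propext (h x)]

theorem comp_fst_fst_fin {n : X → ℕ} {P : (x : X) × Fin (n x) → Prop} (hP : PolyTimePred P)
    (m : X → ℕ) : PolyTimePred fun z : (y : (x : X) × Fin (m x)) × Fin (n y.1) =>
      P ⟨z.1.1, z.2⟩ :=
  let ⟨_, hf, h⟩ := hP
  ⟨_, hf.comp_cons_drop .snd_fin (u := fun z : (y : (x : X) × Fin (m x)) × Fin (n y.1) =>
    (⟨z.1.1, z.2⟩ : (x : X) × Fin (n x))) (j := 2) (fun _ => rfl) fun _ => rfl, fun _ => h _⟩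

theorem getElem?_word (hf : PolyTimeFun f) (s : Γ') :
    PolyTimePred fun x => (word x)[f x]? = some s :=
  ⟨_, hf.ite_getElem?_word s, fun x => by split_ifs with h <;> simp [h]⟩

theorem and (hP : PolyTimePred P) (hQ : PolyTimePred Q) : PolyTimePred fun x => P x ∧ Q x :=
  let ⟨_, hf, h⟩ := hP
  let ⟨_, hg, h'⟩ := hQ
  ⟨_, hf.mul hg, fun x => by rw [CanonicallyOrderedAdd.mul_pos, h, h']⟩

theorem not (hP : PolyTimePred P) : PolyTimePred fun x => ¬ P x :=
  let ⟨_, hf, h⟩ := hP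
  ⟨_, (PolyTimeFun.const 1).tsub hf, fun x => by dsimp only; rw [← h]; omega⟩

theorem or (hP : PolyTimePred P) (hQ : PolyTimePred Q) : PolyTimePred fun x => P x ∨ Q x :=
  (hP.not.and hQ.not).not.congr fun _ => by tauto

theorem lt (hf : PolyTimeFun f) (hg : PolyTimeFun g) : PolyTimePred fun x => f x < g x :=
  ⟨_, hg.tsub hf, fun _ => Nat.sub_pos_iff_lt⟩

theorem le (hf : PolyTimeFun f) (hg : PolyTimeFun g) : PolyTimePred fun x => f x ≤ g x :=
  (lt hg hf).not.congr fun _ => not_lt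

theorem eq (hf : PolyTimeFun f) (hg : PolyTimeFun g) : PolyTimePred fun x => f x = g x :=
  ((le hf hg).and (le hg hf)).congr fun _ => le_antisymm_iff.symm

theorem exists_fin {n : X → ℕ} (hn : PolyTimeFun n) {P : (x : X) × Fin (n x) → Prop}
    (hP : PolyTimePred P) : PolyTimePred fun x => ∃ i, P ⟨x, i⟩ :=
  let ⟨_, hf, h⟩ := hP
  ⟨_, hn.sum hf, fun x => by simp [Nat.pos_iff_ne_zero, ← h]⟩

theorem forall_fin {n : X → ℕ} (hn : PolyTimeFun n) {P : (x : X) × Fin (n x) → Prop}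
    (hP : PolyTimePred P) : PolyTimePred fun x => ∀ i, P ⟨x, i⟩ :=
  (exists_fin hn hP.not).not.congr fun _ => not_exists_not

end PolyTimePred

theorem PolyTimeFun.ite {X : Type} [Context X] {P : X → Prop} [DecidablePred P] {f g : X → ℕ}
    (hP : PolyTimePred P) (hf : PolyTimeFun f) (hg : PolyTimeFun g) :
    PolyTimeFun fun x => if P x then f x else g x := by
  obtain ⟨p, hp, h⟩ := hP
  have hp' := (const 1).tsub hp
  refine ((((const 1).tsub hp').mul hf).add (hp'.mul hg)).congr fun x => ?_
  have hx := h x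
  split_ifs with hPx
  · simp [Nat.sub_eq_zero_of_le (hx.2 hPx)]
  · simp [show p x = 0 by have := mt hx.1 hPx; omega]

theorem DecisionProblem.inP_of_polyTimePred {D : DecisionProblem} (h : PolyTimePred D.Yes) :
    D.InP := by
  obtain ⟨f, hf, hD⟩ := h
  have hone := PolyTimeFun.const (X := D.Inst) 1
  obtain ⟨-, k, T, ⟨p, hp⟩, hrun⟩ := hone.tsub (hone.tsub hf)
  obtain ⟨a, ha⟩ := hrun (k + 1) 0 [] (by simp) (by omega)
  refine inP_of_takes a 0 p (fun I => 1 - (1 - f I)) (fun I => by omega)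
    (fun I => by rw [← hD]; omega) fun I => ?_
  have hsize : size I = (D.encode I).length := Nat.add_zero _
  have hupdate := update_counters (N := k + 1) [] [] 0 (1 - (1 - f I)) (r := 0) rfl
  rw [List.nil_append, counters_zero_cons, counters_nil] at hupdate
  rw [hupdate, ← counters_nil]
  exact (ha I [] rfl rfl).mono (hsize ▸ hp I)

/-! ### Reading the input -/

/-- What a reader of a word that encodes lists of numbers keeps track of: the number of complete
lists, the number of complete entries of the current list, the place value of the next binary digit,
and, for one fixed entry of one fixed list, the value of that entry and the length of that list, as
far as they have been read. -/
structure Scan where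
  list : ℕ
  entry : ℕ
  weight : ℕ
  value : ℕ
  length : ℕ

theorem ofDigits_encodeNat (a : ℕ) : Nat.ofDigits 2 ((encodeNat a).map Bool.toNat) = a := by
  have hpos (p : PosNum) : Nat.ofDigits 2 ((encodePosNum p).map Bool.toNat) = (p : ℕ) := by
    induction p with
    | one => rfl
    | bit0 p ih | bit1 p ih =>
      rw [encodePosNum, List.map_cons, Nat.ofDigits_cons, ih]
      simp
      ring
  have hnum (q : Num) : Nat.ofDigits 2 ((encodeNum q).map Bool.toNat) = (q : ℕ) := by
    obtain _ | p := q
    · rfl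
    · exact hpos p
  rw [encodeNat, hnum, Num.to_of_nat]

namespace Scan

/-- The effect of reading one symbol, when entry `j` of list `i` is to be evaluated. -/
def step (i j : ℕ) (s : Scan) : Γ' → Scan
  | .bit b => { s with
      weight := 2 * s.weight
      value := if s.list = i ∧ s.entry = j ∧ b then s.value + s.weight else s.value }
  | .comma => { s with
      entry := s.entry + 1
      weight := 1
      length := if s.list = i then s.length + 1 else s.length }
  | .ket => { s with list := s.list + 1, entry := 0 }
  | _ => s

/-- The result of reading the word `w`, when entry `j` of list `i` is to be evaluated. -/
def read (i j : ℕ) (w : List Γ') : Scan := w.foldl (step i j) ⟨0, 0, 1, 0, 0⟩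

section decode

variable (i j : ℕ)

theorem foldl_step_map_bit (u : List Bool) (s : Scan) :
    (u.map Γ'.bit).foldl (step i j) s = { s with
      weight := 2 ^ u.length * s.weight
      value := s.value +
        if s.list = i ∧ s.entry = j then s.weight * Nat.ofDigits 2 (u.map Bool.toNat) else 0 } := by
  induction u generalizing s with
  | nil => simp
  | cons b u ih =>
    rw [List.map_cons, List.foldl_cons, ih]
    simp only [step, List.length_cons, pow_succ, List.map_cons, Nat.ofDigits_cons]
    cases b <;> split_ifs <;> simp_all <;> grind

theorem foldl_step_encodeNumber (a k e v l : ℕ) :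
    (encodeNumber a).foldl (step i j) ⟨k, e, 1, v, l⟩ =
      ⟨k, e + 1, 1, v + if k = i ∧ e = j then a else 0, if k = i then l + 1 else l⟩ := by
  simp [encodeNumber, foldl_step_map_bit, ofDigits_encodeNat, step]

theorem foldl_step_flatMap_encodeNumber (L : List ℕ) (k e v l : ℕ) :
    (L.flatMap encodeNumber).foldl (step i j) ⟨k, e, 1, v, l⟩ =
      ⟨k, e + L.length, 1, v + if k = i ∧ e ≤ j then L.getD (j - e) 0 else 0,
        if k = i then l + L.length else l⟩ := by
  induction L generalizing e v l with
  | nil => simp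
  | cons a L ih =>
    rw [List.flatMap_cons, List.foldl_append, foldl_step_encodeNumber, ih]
    clear ih
    obtain hj | rfl | hj := lt_trichotomy e j
    · rw [show j - e = j - (e + 1) + 1 by omega, List.getD_cons_succ]
      grind
    · grind
    · grind

theorem foldl_step_encodeList (L : List ℕ) (k v l : ℕ) :
    (encodeList L).foldl (step i j) ⟨k, 0, 1, v, l⟩ =
      ⟨k + 1, 0, 1, v + if k = i then L.getD j 0 else 0, if k = i then l + L.length else l⟩ := by
  simp [encodeList, foldl_step_flatMap_encodeNumber, step]

theorem foldl_step_encodeLists (L : List (List ℕ)) (k v l : ℕ) :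
    (encodeLists L).foldl (step i j) ⟨k, 0, 1, v, l⟩ =
      ⟨k + L.length, 0, 1, v + if k ≤ i then (L.getD (i - k) []).getD j 0 else 0,
        l + if k ≤ i then (L.getD (i - k) []).length else 0⟩ := by
  induction L generalizing k v l with
  | nil => simp [encodeLists]
  | cons a L ih =>
    rw [encodeLists, List.flatMap_cons, List.foldl_append, foldl_step_encodeList, ← encodeLists, ih]
    clear ih
    obtain hi | rfl | hi := lt_trichotomy k i
    · rw [show i - k = i - (k + 1) + 1 by omega, List.getD_cons_succ]
      grind
    · grind
    · grind

theorem read_encodeLists (L : List (List ℕ)) :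
    read i j (encodeLists L) = ⟨L.length, 0, 1, (L.getD i []).getD j 0, (L.getD i []).length⟩ := by
  simp [read, foldl_step_encodeLists]

theorem read_take_succ {w : List Γ'} {p : ℕ} (hp : p < w.length) :
    read i j (w.take (p + 1)) = step i j (read i j (w.take p)) w[p] := by
  rw [List.take_succ_eq_append_getElem hp, read, List.foldl_append]
  rfl

theorem read_le_length (w : List Γ') :
    (read i j w).list ≤ w.length ∧ (read i j w).entry ≤ w.length ∧
      (read i j w).length ≤ w.length := by
  induction w using List.reverseRecOn with
  | nil => simp [read]
  | append_singleton w s ih =>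
    rw [read, List.foldl_append, ← read]
    simp only [List.foldl_cons, List.foldl_nil, List.length_append, List.length_singleton]
    cases s <;> simp only [step] <;> grind

end decode

section PolyTimeFun

variable {X : Type} [Context X] {n i j : X → ℕ}

theorem polyTimeFun_list (hn : PolyTimeFun n) (hle : ∀ x, n x ≤ (word x).length) :
    PolyTimeFun fun x => (read (i x) (j x) ((word x).take (n x))).list := by
  refine PolyTimeFun.iterate hn (F := fun x p => (read (i x) (j x) ((word x).take p)).list)
    .length_word (fun x p _ => ?_) .zero
    (s := fun y => y.2 + if (word y.1.1)[(y.1.2 : ℕ)]? = some .ket then 1 else 0)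
    (PolyTimeFun.snd.add (PolyTimeFun.snd_fin.comp_fst.ite_getElem?_word _)) fun x p => ?_
  · exact (read_le_length _ _ _).1.trans (List.length_take_le' _ _)
  · have hp := p.is_lt.trans_le (hle x)
    simp only [read_take_succ _ _ hp, List.getElem?_eq_getElem hp]
    cases (word x)[(p : ℕ)] <;> simp [step]

theorem polyTimeFun_entry (hn : PolyTimeFun n) (hle : ∀ x, n x ≤ (word x).length) :
    PolyTimeFun fun x => (read (i x) (j x) ((word x).take (n x))).entry := by
  have hp : PolyTimeFun fun y : ((x : X) × Fin (n x)) × ℕ => (y.1.2 : ℕ) :=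
    PolyTimeFun.snd_fin.comp_fst
  refine PolyTimeFun.iterate hn (F := fun x p => (read (i x) (j x) ((word x).take p)).entry)
    .length_word (fun x p _ => ?_) .zero
    (s := fun y => if (word y.1.1)[(y.1.2 : ℕ)]? = some .ket then 0 else
      y.2 + if (word y.1.1)[(y.1.2 : ℕ)]? = some .comma then 1 else 0)
    (.ite (.getElem?_word hp _) .zero (PolyTimeFun.snd.add (hp.ite_getElem?_word _))) fun x p => ?_
  · exact (read_le_length _ _ _).2.1.trans (List.length_take_le' _ _)
  · have hp := p.is_lt.trans_le (hle x)
    simp only [read_take_succ _ _ hp, List.getElem?_eq_getElem hp]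
    cases (word x)[(p : ℕ)] <;> simp [step]

theorem polyTimeFun_min_weight (hn : PolyTimeFun n) (hle : ∀ x, n x ≤ (word x).length) :
    PolyTimeFun fun x =>
      min (read (i x) (j x) ((word x).take (n x))).weight (word x).length := by
  have hp : PolyTimeFun fun y : ((x : X) × Fin (n x)) × ℕ => (y.1.2 : ℕ) :=
    PolyTimeFun.snd_fin.comp_fst
  refine PolyTimeFun.iterate hn
    (F := fun x p => min (read (i x) (j x) ((word x).take p)).weight (word x).length)
    .length_word (fun x p _ => min_le_right _ _) ((PolyTimeFun.const 1).min .length_word)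
    (s := fun y => if (word y.1.1)[(y.1.2 : ℕ)]? = some .comma then 1 else
      if (word y.1.1)[(y.1.2 : ℕ)]? = some (.bit true) ∨
        (word y.1.1)[(y.1.2 : ℕ)]? = some (.bit false) then min (y.2 + y.2) (word y.1.1).length
      else y.2)
    (.ite (.getElem?_word hp _) (.const 1) (.ite (.or (.getElem?_word hp _) (.getElem?_word hp _))
      ((PolyTimeFun.snd.add .snd).min .length_word) .snd)) fun x p => ?_
  have hp := p.is_lt.trans_le (hle x)
  simp only [read_take_succ _ _ hp, List.getElem?_eq_getElem hp]
  cases (word x)[(p : ℕ)] with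
  | bit b => cases b <;> simp [step] <;> omega
  | _ => simp [step] <;> omega

theorem polyTimeFun_min_value (hi : PolyTimeFun i) (hj : PolyTimeFun j) :
    PolyTimeFun fun x => min (read (i x) (j x) (word x)).value (word x).length := by
  have hp : PolyTimeFun fun y : ((x : X) × Fin (word x).length) × ℕ => (y.1.2 : ℕ) :=
    PolyTimeFun.snd_fin.comp_fst
  have hle (y : ((x : X) × Fin (word x).length) × ℕ) : (y.1.2 : ℕ) ≤ (word y).length :=
    y.1.2.is_lt.le
  refine (PolyTimeFun.iterate .length_word
    (F := fun x p => min (read (i x) (j x) ((word x).take p)).value (word x).length)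
    .length_word (fun x p _ => min_le_right _ _) (PolyTimeFun.zero.congr fun x => by simp [read])
    (s := fun y =>
      if (read (i y.1.1) (j y.1.1) ((word y).take y.1.2)).list = i y.1.1 ∧
        (read (i y.1.1) (j y.1.1) ((word y).take y.1.2)).entry = j y.1.1 ∧
        (word y.1.1)[(y.1.2 : ℕ)]? = some (.bit true)
      then min (y.2 + min (read (i y.1.1) (j y.1.1) ((word y).take y.1.2)).weight (word y).length)
        (word y).length
      else y.2)
    (.ite (.and (.eq (polyTimeFun_list hp hle) hi.comp_fst_fin.comp_fst)
        (.and (.eq (polyTimeFun_entry hp hle) hj.comp_fst_fin.comp_fst) (.getElem?_word hp _)))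
      ((PolyTimeFun.snd.add (polyTimeFun_min_weight hp hle)).min .length_word) .snd)
    fun x p => ?_).congr fun x => by rw [List.take_length]
  simp only [read_take_succ _ _ p.is_lt, List.getElem?_eq_getElem p.is_lt]
  change _ = if (read (i x) (j x) ((word x).take p)).list = i x ∧
    (read (i x) (j x) ((word x).take p)).entry = j x ∧ _ then min
      (_ + min (read (i x) (j x) ((word x).take p)).weight (word x).length) (word x).length else _
  cases (word x)[(p : ℕ)] with
  | bit b => simp [step] ; grind
  | _ => simp [step]

theorem polyTimeFun_length (hi : PolyTimeFun i) :
    PolyTimeFun fun x => (read (i x) (j x) (word x)).length := by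
  have hp : PolyTimeFun fun y : ((x : X) × Fin (word x).length) × ℕ => (y.1.2 : ℕ) :=
    PolyTimeFun.snd_fin.comp_fst
  have hle (y : ((x : X) × Fin (word x).length) × ℕ) : (y.1.2 : ℕ) ≤ (word y).length :=
    y.1.2.is_lt.le
  refine (PolyTimeFun.iterate .length_word
    (F := fun x p => (read (i x) (j x) ((word x).take p)).length)
    .length_word (fun x p _ => (read_le_length _ _ _).2.2.trans (List.length_take_le' _ _)) .zero
    (s := fun y => if (read (i y.1.1) (j y.1.1) ((word y).take y.1.2)).list = i y.1.1 ∧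
      (word y.1.1)[(y.1.2 : ℕ)]? = some .comma then y.2 + 1 else y.2)
    (.ite (.and (.eq (polyTimeFun_list hp hle) hi.comp_fst_fin.comp_fst) (.getElem?_word hp _))
      PolyTimeFun.snd.succ .snd) fun x p => ?_).congr fun x => by rw [List.take_length]
  simp only [read_take_succ _ _ p.is_lt, List.getElem?_eq_getElem p.is_lt]
  change _ = if (read (i x) (j x) ((word x).take p)).list = i x ∧ _ then _ else _
  cases (word x)[(p : ℕ)] <;> simp [step]

end PolyTimeFun

end Scan

section Lists

variable {X : Type} [Context X] {L : X → List (List ℕ)} {i j : X → ℕ}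

theorem length_le_length_encodeLists (L : List (List ℕ)) : L.length ≤ (encodeLists L).length := by
  simpa only [Scan.read_encodeLists] using (Scan.read_le_length 0 0 (encodeLists L)).1

theorem length_getD_le_length_encodeLists (L : List (List ℕ)) (i : ℕ) :
    (L.getD i []).length ≤ (encodeLists L).length := by
  simpa only [Scan.read_encodeLists] using (Scan.read_le_length i 0 (encodeLists L)).2.2

theorem polyTimeFun_length_lists (hL : ∀ x, word x = encodeLists (L x)) :
    PolyTimeFun fun x => (L x).length :=
  (Scan.polyTimeFun_list (i := 0) (j := 0) .length_word fun _ => le_rfl).congr fun x => by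
    rw [List.take_length, hL, Scan.read_encodeLists]

theorem polyTimeFun_length_getD (hL : ∀ x, word x = encodeLists (L x)) (hi : PolyTimeFun i) :
    PolyTimeFun fun x => ((L x).getD (i x) []).length :=
  (Scan.polyTimeFun_length (j := 0) hi).congr fun x => by rw [hL, Scan.read_encodeLists]

theorem polyTimeFun_min_getD_getD (hL : ∀ x, word x = encodeLists (L x)) (hi : PolyTimeFun i)
    (hj : PolyTimeFun j) :
    PolyTimeFun fun x => min (((L x).getD (i x) []).getD (j x) 0) (word x).length :=
  (Scan.polyTimeFun_min_value hi hj).congr fun x => by rw [hL, Scan.read_encodeLists]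

theorem polyTimeFun_getD_getD (hL : ∀ x, word x = encodeLists (L x)) (hi : PolyTimeFun i)
    (hj : PolyTimeFun j) (hle : ∀ x, ((L x).getD (i x) []).getD (j x) 0 ≤ (word x).length) :
    PolyTimeFun fun x => ((L x).getD (i x) []).getD (j x) 0 :=
  (polyTimeFun_min_getD_getD hL hi hj).congr fun x => min_eq_left (hle x)

theorem polyTimeFun_symm_apply (hL : ∀ x, word x = encodeLists (L x)) {m : X → ℕ}
    (hm : PolyTimeFun m) (hi : PolyTimeFun i) {σ : ∀ x, Pref (m x)}
    (hσ : ∀ x, (L x).getD (i x) [] = (σ x).toList) {c : ∀ x, Fin (m x)}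
    (hc : PolyTimeFun fun x => (c x : ℕ)) : PolyTimeFun fun x => ((σ x).symm (c x) : ℕ) := by
  have hσp (x : X) (p : Fin (m x)) : ((L x).getD (i x) []).getD p 0 = σ x p := by
    rw [hσ, Pref.toList]
    simp
  have hentry : PolyTimeFun fun y : (x : X) × Fin (m x) =>
      ((L y.1).getD (i y.1) []).getD y.2 0 :=
    polyTimeFun_getD_getD (fun y => hL y.1) hi.comp_fst_fin .snd_fin fun y => by
      have hlen := length_getD_le_length_encodeLists (L y.1) (i y.1)
      rw [hσ, Pref.toList, List.length_ofFn, ← hL] at hlen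
      exact (hσp y.1 y.2).trans_le ((σ y.1 y.2).is_lt.le.trans hlen)
  refine (hm.sum (.ite (.eq hentry hc.comp_fst_fin) .snd_fin .zero)).congr fun x => ?_
  simp only [hσp, Fin.val_inj, ← Equiv.eq_symm_apply]
  simp

end Lists

end PolyTime

open Context Finset

/-! ### Winners -/

section Winner

variable {n m : ℕ}

/-- The indicator that the tie-breaking preference `t` ranks `c` before `y`: what `c` gains over `y`
when their scores are equal. -/
def tiePenalty (t : Pref m) (c y : Fin m) : ℕ := if t.symm c < t.symm y then 1 else 0

theorem tiePenalty_self (t : Pref m) (y : Fin m) : tiePenalty t y y = 0 :=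
  if_neg (lt_irrefl _)

theorem tiePenalty_add_tiePenalty (t : Pref m) {c y : Fin m} (h : c ≠ y) :
    tiePenalty t c y + tiePenalty t y c = 1 := by
  have : t.symm c ≠ t.symm y := fun h' => h (t.symm.injective h')
  unfold tiePenalty
  grind

theorem tiePenalty_le_add (t : Pref m) (c x y : Fin m) :
    tiePenalty t c y ≤ tiePenalty t c x + tiePenalty t x y := by
  unfold tiePenalty
  grind

theorem scoringRule_mem_coWinners (hm : 0 < m) (α : Fin m → ℕ) (t : Pref m) (P : Profile n m) :
    scoringRule hm α t P ∈ coWinners α P := by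
  obtain ⟨x, hx, hxe⟩ := mem_map.1 (min'_mem _ ((coWinners_nonempty hm α P).map
    (f := t.symm.toEmbedding)))
  rw [scoringRule, tieBreak, ← hxe]
  simpa using hx

theorem symm_scoringRule_le (hm : 0 < m) (α : Fin m → ℕ) (t : Pref m) {P : Profile n m}
    {c : Fin m} (hc : c ∈ coWinners α P) : t.symm (scoringRule hm α t P) ≤ t.symm c := by
  rw [scoringRule, tieBreak, Equiv.symm_apply_apply]
  exact min'_le _ _ (mem_map_of_mem t.symm.toEmbedding hc)

theorem score_add_tiePenalty_le (hm : 0 < m) (α : Fin m → ℕ) (t : Pref m) (P : Profile n m)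
    (c : Fin m) :
    score α P c + tiePenalty t c (scoringRule hm α t P) ≤ score α P (scoringRule hm α t P) := by
  have hmax : ∀ d, score α P d ≤ score α P (scoringRule hm α t P) := by
    simpa [coWinners] using scoringRule_mem_coWinners hm α t P
  by_cases hc : c ∈ coWinners α P
  · rw [tiePenalty, if_neg (not_lt.2 (symm_scoringRule_le hm α t hc))]
    exact hmax c
  · have hlt : score α P c < score α P (scoringRule hm α t P) := by
      obtain ⟨d, hd⟩ : ∃ d, score α P c < score α P d := by simpa [coWinners] using hc
      exact hd.trans_le (hmax d)
    unfold tiePenalty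
    split_ifs <;> omega

theorem scoringRule_eq_iff {hm : 0 < m} {α : Fin m → ℕ} {t : Pref m} {P : Profile n m}
    {y : Fin m} : scoringRule hm α t P = y ↔
      ∀ c, score α P c + tiePenalty t c y ≤ score α P y := by
  constructor
  · rintro rfl
    exact score_add_tiePenalty_le hm α t P
  · intro h
    by_contra hne
    have h₁ := h (scoringRule hm α t P)
    have h₂ := score_add_tiePenalty_le hm α t P y
    have h₃ := tiePenalty_add_tiePenalty t hne
    omega

/-- The score of `c` from the votes of the voters outside `M`. -/
def outScore (α : Fin m → ℕ) (P : Profile n m) (M : Finset (Fin n)) (c : Fin m) : ℕ :=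
  ∑ v, if v ∈ M then 0 else α ((P v).symm c)

theorem score_eq_outScore_add (α : Fin m → ℕ) (P : Profile n m) (M : Finset (Fin n)) (c : Fin m) :
    score α P c = outScore α P M c + ∑ v ∈ M, α ((P v).symm c) := by
  rw [score, outScore, sum_ite, sum_const_zero, zero_add, add_comm,
    ← sum_filter_add_sum_filter_not univ (· ∈ M), filter_univ_mem]

theorem score_piecewise (α : Fin m → ℕ) (P P' : Profile n m) (M : Finset (Fin n)) (c : Fin m) :
    score α (M.piecewise P' P) c = outScore α P M c + ∑ v ∈ M, α ((P' v).symm c) := by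
  rw [score_eq_outScore_add _ _ M]
  congr 1
  · refine sum_congr rfl fun v _ => ?_
    by_cases hv : v ∈ M <;> simp [hv]
  · exact sum_congr rfl fun v hv => by simp [hv]

end Winner

/-! ### Manipulation under score vectors whose smallest gap is at the top -/

section MinGap

variable {n m : ℕ}

theorem exists_symm_eq_symm_eq_forall_le (σ : Pref m) {x y i₀ i₁ : Fin m} (hxy : x ≠ y)
    (h₀ : (i₀ : ℕ) = 0) (h₁ : (i₁ : ℕ) = 1) :
    ∃ σ' : Pref m, σ'.symm x = i₀ ∧ σ'.symm y = i₁ ∧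
      ∀ z, z ≠ x → z ≠ y → σ.symm z ≤ σ'.symm z := by
  have h01 : i₀ ≠ i₁ := fun h => by omega
  set ρ : Fin m ≃ Fin m := σ.symm.trans (Equiv.swap i₀ (σ.symm x)) with hρ
  have hρx : ρ x = i₀ := by simp [hρ]
  have hρy : ρ y ≠ i₀ := hρx ▸ ρ.injective.ne hxy.symm
  refine ⟨(ρ.trans (Equiv.swap i₁ (ρ y))).symm, ?_, ?_, fun z hzx hzy => ?_⟩
  · rw [Equiv.symm_symm, Equiv.trans_apply, hρx, Equiv.swap_apply_of_ne_of_ne h01 hρy.symm]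
  · simp
  have hσρ : σ.symm z ≤ ρ z := by
    rw [hρ, Equiv.trans_apply]
    by_cases hz : σ.symm z = i₀
    · exact Fin.le_def.2 (by omega)
    · rw [Equiv.swap_apply_of_ne_of_ne hz (σ.symm.injective.ne hzx)]
  change σ.symm z ≤ Equiv.swap i₁ (ρ y) (ρ z)
  refine hσρ.trans ?_
  by_cases hz : ρ z = i₁
  · rw [hz, Equiv.swap_apply_left]
    exact Fin.le_def.2 (by omega)
  · rw [Equiv.swap_apply_of_ne_of_ne hz (ρ.injective.ne hzy)]

/-- The first two entries of the score vector differ by `g`, and any two entries by at least `g`: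
a vote ranking `x` above `y` gives `x` at least `g` points more than `y`, and ranking them first
and second attains this minimum. -/
structure HasMinGap (α : Fin m → ℕ) (g : ℕ) : Prop where
  add_le : ∀ i j, i < j → α j + g ≤ α i
  top : ∀ i₀ i₁ : Fin m, (i₀ : ℕ) = 0 → (i₁ : ℕ) = 1 → α i₀ = α i₁ + g

theorem HasMinGap.antitone {α : Fin m → ℕ} {g : ℕ} (hα : HasMinGap α g) : Antitone α :=
  antitone_iff_forall_lt.2 fun i j h => le_of_add_le_left (hα.add_le i j h)

theorem one_lt_of_ne {x y : Fin m} (h : x ≠ y) : 1 < m := by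
  by_contra hm
  exact h (Fin.ext (by omega))

variable {α : Fin m → ℕ} {g : ℕ} {hm : 0 < m} {t : Pref m} {P : Profile n m}
  {M : Finset (Fin n)} {x y : Fin m}

theorem outScore_le_of_isCoalitionAgainst (hα : HasMinGap α g)
    (h : IsCoalitionAgainst (scoringRule hm α t) P M y) :
    outScore α P M (scoringRule hm α t P) + g * #M + tiePenalty t (scoringRule hm α t P) y ≤
      outScore α P M y := by
  obtain ⟨-, P', hP', h⟩ := h
  generalize scoringRule hm α t P = x at *
  have hwin := scoringRule_eq_iff.1 h x
  have hgap : ∑ v ∈ M, (α ((P' v).symm y) + g) ≤ ∑ v ∈ M, α ((P' v).symm x) :=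
    sum_le_sum fun v hv => hα.add_le _ _ (hP' v hv)
  rw [sum_add_distrib, sum_const, smul_eq_mul, mul_comm] at hgap
  rw [score_piecewise, score_piecewise] at hwin
  omega

theorem exists_score_piecewise_first_second (hα : Antitone α) (P : Profile n m)
    (M : Finset (Fin n)) {i₀ i₁ : Fin m} (hxy : x ≠ y) (h₀ : (i₀ : ℕ) = 0) (h₁ : (i₁ : ℕ) = 1) :
    ∃ P' : Profile n m, (∀ v, (P' v).Prefers x y) ∧
      score α (M.piecewise P' P) x = outScore α P M x + #M * α i₀ ∧
      score α (M.piecewise P' P) y = outScore α P M y + #M * α i₁ ∧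
      ∀ c, c ≠ x → c ≠ y → score α (M.piecewise P' P) c ≤ score α P c := by
  choose P' hx hy hz using fun v => exists_symm_eq_symm_eq_forall_le (P v) hxy h₀ h₁
  refine ⟨P', fun v => ?_, by simp [score_piecewise, hx], by simp [score_piecewise, hy],
    fun c hcx hcy => ?_⟩
  · rw [Pref.Prefers, hx, hy]
    exact Fin.lt_def.2 (by omega)
  · rw [score_piecewise, score_eq_outScore_add α P M]
    exact Nat.add_le_add_left (sum_le_sum fun v _ => hα (hz v c hcx hcy)) _

theorem isCoalitionAgainst_of_outScore_le (hα : HasMinGap α g)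
    (hy : y ≠ scoringRule hm α t P)
    (h : outScore α P M (scoringRule hm α t P) + g * #M + tiePenalty t (scoringRule hm α t P) y ≤
      outScore α P M y) :
    IsCoalitionAgainst (scoringRule hm α t) P M y := by
  refine ⟨hy, ?_⟩
  have hwin := score_add_tiePenalty_le hm α t P
  generalize scoringRule hm α t P = x at *
  set i₀ : Fin m := ⟨0, hm⟩
  set i₁ : Fin m := ⟨1, one_lt_of_ne hy⟩
  obtain ⟨P', hP', hsx, hsy, hs⟩ :=
    exists_score_piecewise_first_second hα.antitone P M (i₀ := i₀) (i₁ := i₁) hy.symm rfl rfl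
  refine ⟨P', fun v _ => hP' v, scoringRule_eq_iff.2 fun c => ?_⟩
  have hxy : score α (M.piecewise P' P) x + tiePenalty t x y ≤ score α (M.piecewise P' P) y := by
    rw [hsx, hsy, hα.top i₀ i₁ rfl rfl, mul_add, mul_comm #M g]
    omega
  have hx_le : score α P x ≤ score α (M.piecewise P' P) x := by
    rw [hsx, score_eq_outScore_add α P M, ← smul_eq_mul]
    exact Nat.add_le_add_left (sum_le_card_nsmul _ _ _
      fun v _ => hα.antitone (Fin.le_def.2 (Nat.zero_le _))) _
  rcases eq_or_ne c x with rfl | hcx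
  · exact hxy
  rcases eq_or_ne c y with rfl | hcy
  · rw [tiePenalty_self, add_zero]
  have := hs c hcx hcy
  have := tiePenalty_le_add t c x y
  have := hwin c
  omega

theorem isCoalitionAgainst_iff_of_hasMinGap (hα : HasMinGap α g) :
    IsCoalitionAgainst (scoringRule hm α t) P M y ↔ y ≠ scoringRule hm α t P ∧
      outScore α P M (scoringRule hm α t P) + g * #M + tiePenalty t (scoringRule hm α t P) y ≤
        outScore α P M y :=
  ⟨fun h => ⟨h.1, outScore_le_of_isCoalitionAgainst hα h⟩,
    fun h => isCoalitionAgainst_of_outScore_le hα h.1 h.2⟩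

theorem exists_card_eq_forall_notMem_le {ι : Type} [Fintype ι] (d : ι → ℕ) {k : ℕ}
    (hk : k ≤ Fintype.card ι) :
    ∃ M : Finset ι, #M = k ∧ ∀ u ∉ M, ∀ v ∈ M, d u ≤ d v := by
  classical
  induction k with
  | zero => exact ⟨∅, rfl, by simp⟩
  | succ k ih =>
    obtain ⟨M, hM, h⟩ := ih (by omega)
    have hne : Mᶜ.Nonempty := by
      rw [← card_pos, card_compl]
      omega
    obtain ⟨w, hw, hmax⟩ := exists_max_image Mᶜ d hne
    rw [mem_compl] at hw
    refine ⟨insert w M, by rw [card_insert_of_notMem hw, hM], fun u hu v hv => ?_⟩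
    rw [mem_insert, not_or] at hu
    rcases mem_insert.1 hv with rfl | hv
    · exact hmax u (mem_compl.2 hu.2)
    · exact h u hu.2 v hv

theorem sum_eq_sum_card_filter_lt {ι : Type} (s : Finset ι) {d : ι → ℕ} {J : ℕ}
    (hJ : ∀ v, d v ≤ J) : ∑ v ∈ s, d v = ∑ j : Fin J, #{v ∈ s | j < d v} := by
  simp_rw [card_filter]
  rw [sum_comm]
  refine sum_congr rfl fun v _ => ?_
  rw [← card_filter, Fin.card_filter_val_lt, min_eq_right (hJ v)]

theorem exists_card_le_and_le_sum_iff {ι : Type} [Fintype ι] {d : ι → ℕ} {J : ℕ}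
    (hJ : ∀ v, d v ≤ J) (b k : ℕ) :
    (∃ M : Finset ι, #M ≤ k ∧ b ≤ ∑ v ∈ M, d v) ↔
      b ≤ ∑ j : Fin J, min k #{v | j < d v} := by
  constructor
  · rintro ⟨M, hM, hb⟩
    rw [sum_eq_sum_card_filter_lt M hJ] at hb
    exact hb.trans <| sum_le_sum fun j _ => le_min ((card_filter_le _ _).trans hM)
      (card_le_card (filter_subset_filter _ (subset_univ M)))
  · intro hb
    obtain ⟨M, hM, hmax⟩ := exists_card_eq_forall_notMem_le d (min_le_right k (Fintype.card ι))
    refine ⟨M, hM.trans_le (min_le_left _ _), hb.trans ?_⟩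
    rw [sum_eq_sum_card_filter_lt M hJ]
    refine sum_le_sum fun j _ => ?_
    by_cases hj : ∀ v ∈ M, j < d v
    · rw [filter_true_of_mem hj, hM]
      exact min_le_min_left _ (card_le_univ _)
    · push Not at hj
      obtain ⟨v, hv, hjv⟩ := hj
      refine (min_le_right _ _).trans (card_le_card fun u hu => ?_)
      rw [mem_filter_univ] at hu
      refine mem_filter.2 ⟨by_contra fun hu' => ?_, hu⟩
      exact (hu.trans_le (hmax u hu' v hv)).not_ge hjv

theorem exists_card_le_and_add_sum_le_add_sum_iff {ι : Type} (f h : ι → ℕ) (a b k : ℕ) :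
    (∃ M : Finset ι, #M ≤ k ∧ a + ∑ v ∈ M, f v ≤ b + ∑ v ∈ M, h v) ↔
      ∃ M : Finset ι, #M ≤ k ∧ a ≤ b + ∑ v ∈ M, (h v - f v) := by
  constructor
  · rintro ⟨M, hM, hle⟩
    refine ⟨M, hM, ?_⟩
    have : ∑ v ∈ M, h v ≤ ∑ v ∈ M, f v + ∑ v ∈ M, (h v - f v) := by
      rw [← sum_add_distrib]
      exact sum_le_sum fun v _ => by omega
    omega
  · rintro ⟨M, hM, hle⟩
    refine ⟨{v ∈ M | h v - f v ≠ 0}, (card_filter_le _ _).trans hM, ?_⟩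
    have hpos : ∑ v ∈ M with h v - f v ≠ 0, h v =
        ∑ v ∈ M with h v - f v ≠ 0, f v + ∑ v ∈ M with h v - f v ≠ 0, (h v - f v) := by
      rw [← sum_add_distrib]
      refine sum_congr rfl fun v hv => ?_
      have := (mem_filter.1 hv).2
      omega
    rw [hpos, sum_filter_ne_zero]
    omega

theorem outScore_add_le_iff :
    outScore α P M x + g * #M + tiePenalty t x y ≤ outScore α P M y ↔
      score α P x + tiePenalty t x y + ∑ v ∈ M, (α ((P v).symm y) + g) ≤
        score α P y + ∑ v ∈ M, α ((P v).symm x) := by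
  rw [score_eq_outScore_add α P M x, score_eq_outScore_add α P M y, sum_add_distrib,
    sum_const, smul_eq_mul, mul_comm]
  omega

theorem exists_isCoalitionAgainst_iff_of_hasMinGap (hα : HasMinGap α g) {J : ℕ}
    (hJ : ∀ i, α i ≤ J) (k : ℕ) :
    (∃ M : Finset (Fin n), #M ≤ k ∧ IsCoalitionAgainst (scoringRule hm α t) P M y) ↔
      y ≠ scoringRule hm α t P ∧
      score α P (scoringRule hm α t P) + tiePenalty t (scoringRule hm α t P) y ≤
        score α P y + ∑ j : Fin J, min k #{v | j <
          α ((P v).symm (scoringRule hm α t P)) - (α ((P v).symm y) + g)} := by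
  simp only [isCoalitionAgainst_iff_of_hasMinGap hα, outScore_add_le_iff,
    and_left_comm (b := y ≠ scoringRule hm α t P), exists_and_left]
  rw [exists_card_le_and_add_sum_le_add_sum_iff]
  simp only [← Nat.sub_le_iff_le_add']
  rw [exists_card_le_and_le_sum_iff fun v => (Nat.sub_le _ _).trans (hJ _)]

end MinGap

/-! ### Manipulation under plurality -/

section Plurality

variable {n m : ℕ}

/-- The score vector of plurality. -/
def pluralityVec (i : Fin m) : ℕ := if (i : ℕ) = 0 then 1 else 0

theorem pluralityVec_symm (σ : Pref m) (hm : 0 < m) (c : Fin m) :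
    pluralityVec (σ.symm c) = if σ ⟨0, hm⟩ = c then 1 else 0 := by
  unfold pluralityVec
  congr 1
  rw [← Equiv.eq_symm_apply, Fin.ext_iff]
  exact propext eq_comm

theorem exists_pref_apply_zero_eq {c x y : Fin m} (hm : 0 < m) (hcy : c ≠ y) (hxy : x ≠ y) :
    ∃ σ : Pref m, σ ⟨0, hm⟩ = c ∧ σ.Prefers x y := by
  set i₀ : Fin m := ⟨0, hm⟩
  set i₁ : Fin m := ⟨1, one_lt_of_ne hcy⟩
  have hi : i₀ < i₁ := Fin.lt_def.2 Nat.zero_lt_one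
  by_cases hcx : c = x
  · obtain ⟨σ, hσc, hσy, -⟩ := exists_symm_eq_symm_eq_forall_le (1 : Pref m) (i₀ := i₀) (i₁ := i₁)
      hcy rfl rfl
    exact ⟨σ, by rw [← hσc, σ.apply_symm_apply], by rwa [Pref.Prefers, ← hcx, hσc, hσy]⟩
  · obtain ⟨σ, hσc, hσx, -⟩ := exists_symm_eq_symm_eq_forall_le (1 : Pref m) (i₀ := i₀) (i₁ := i₁)
      hcx rfl rfl
    have hyc : σ.symm y ≠ i₀ := hσc ▸ σ.symm.injective.ne hcy.symm
    have hyx : σ.symm y ≠ i₁ := hσx ▸ σ.symm.injective.ne hxy.symm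
    refine ⟨σ, by rw [← hσc, σ.apply_symm_apply], ?_⟩
    rw [Pref.Prefers, hσx]
    grind

theorem exists_forall_card_filter_eq_le {ι κ : Type} [DecidableEq κ] [Fintype κ] [Nonempty κ]
    (M : Finset ι) {cap : κ → ℕ} (h : #M ≤ ∑ c, cap c) :
    ∃ f : ι → κ, ∀ c, #{v ∈ M | f v = c} ≤ cap c := by
  classical
  induction M using Finset.induction with
  | empty => exact ⟨fun _ => Classical.arbitrary κ, by simp⟩
  | insert w M hw ih =>
    rw [card_insert_of_notMem hw] at h
    obtain ⟨f, hf⟩ := ih (by omega)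
    obtain ⟨c₀, -, hc₀⟩ : ∃ c ∈ univ, #{v ∈ M | f v = c} < cap c :=
      exists_lt_of_sum_lt (by rw [← card_eq_sum_card_fiberwise (by simp)]; omega)
    refine ⟨Function.update f w c₀, fun c => ?_⟩
    have hM : {v ∈ M | Function.update f w c₀ v = c} = {v ∈ M | f v = c} :=
      filter_congr fun v hv => by rw [Function.update_of_ne (ne_of_mem_of_not_mem hv hw)]
    rw [filter_insert, hM, Function.update_self]
    split_ifs with hc
    · exact (card_insert_le _ _).trans (hc ▸ hc₀)
    · exact hf c

theorem sum_pluralityVec (hm : 0 < m) (P : Profile n m) (M : Finset (Fin n)) (c : Fin m) :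
    ∑ v ∈ M, pluralityVec ((P v).symm c) = #{v ∈ M | P v ⟨0, hm⟩ = c} := by
  simp only [pluralityVec_symm _ hm, sum_boole, Nat.cast_id]

theorem sum_sum_pluralityVec (hm : 0 < m) (P : Profile n m) (M : Finset (Fin n)) :
    ∑ c, ∑ v ∈ M, pluralityVec ((P v).symm c) = #M := by
  simp only [sum_pluralityVec hm]
  exact (card_eq_sum_card_fiberwise (by simp)).symm

theorem sum_outScore_pluralityVec_add_card (hm : 0 < m) (P : Profile n m) (M : Finset (Fin n)) :
    ∑ c, outScore pluralityVec P M c + #M = n := by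
  have h := sum_sum_pluralityVec hm P univ
  rw [card_univ, Fintype.card_fin] at h
  rw [← sum_sum_pluralityVec hm P M, ← sum_add_distrib]
  exact (sum_congr rfl fun c _ => (score_eq_outScore_add pluralityVec P M c).symm).trans h

variable {hm : 0 < m} {t : Pref m} {P : Profile n m} {M : Finset (Fin n)} {y : Fin m}

theorem exists_forall_sum_pluralityVec_le {cap : Fin m → ℕ} {x : Fin m} (hxy : x ≠ y)
    (hcap : cap y = 0) (hM : #M ≤ ∑ c, cap c) :
    ∃ P' : Profile n m, (∀ v ∈ M, (P' v).Prefers x y) ∧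
      ∀ c, ∑ v ∈ M, pluralityVec ((P' v).symm c) ≤ cap c := by
  have hm : 0 < m := x.pos
  have : Nonempty (Fin m) := ⟨x⟩
  obtain ⟨f, hf⟩ := exists_forall_card_filter_eq_le M hM
  have hfy : ∀ v ∈ M, f v ≠ y := by
    simpa [hcap, filter_eq_empty_iff] using hf y
  have hvote : ∀ v, ∃ σ : Pref m, v ∈ M → σ ⟨0, hm⟩ = f v ∧ σ.Prefers x y := fun v => by
    by_cases hv : v ∈ M
    · obtain ⟨σ, hσ⟩ := exists_pref_apply_zero_eq hm (hfy v hv) hxy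
      exact ⟨σ, fun _ => hσ⟩
    · exact ⟨1, fun h => absurd h hv⟩
  choose P' hP' using hvote
  refine ⟨P', fun v hv => (hP' v hv).2, fun c => ?_⟩
  rw [sum_pluralityVec hm, filter_congr fun v hv => by rw [(hP' v hv).1]]
  exact hf c

theorem isCoalitionAgainst_plurality_iff :
    IsCoalitionAgainst (scoringRule hm pluralityVec t) P M y ↔
      y ≠ scoringRule hm pluralityVec t P ∧
      (∀ c, outScore pluralityVec P M c + tiePenalty t c y ≤ outScore pluralityVec P M y) ∧
      n ≤ ∑ c, (outScore pluralityVec P M y - tiePenalty t c y) := by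
  have hn := sum_outScore_pluralityVec_add_card hm P M
  refine and_congr_right fun hy => ?_
  generalize scoringRule hm pluralityVec t P = x at *
  simp only [scoringRule_eq_iff, score_piecewise]
  constructor
  · rintro ⟨P', hP', h⟩
    have hy0 : ∑ v ∈ M, pluralityVec ((P' v).symm y) = 0 :=
      sum_eq_zero fun v hv => if_neg (Nat.ne_zero_of_lt (Fin.lt_def.1 (hP' v hv)))
    rw [hy0, add_zero] at h
    refine ⟨fun c => (Nat.add_le_add_right (Nat.le_add_right _ _) _).trans (h c), ?_⟩
    rw [← sum_sum_pluralityVec hm P' M, ← sum_add_distrib] at hn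
    exact hn.ge.trans (sum_le_sum fun c _ => Nat.le_sub_of_add_le (h c))
  · rintro ⟨hout, hsum⟩
    obtain ⟨P', hP', hcap⟩ := exists_forall_sum_pluralityVec_le (M := M)
      (cap := fun c => outScore pluralityVec P M y - tiePenalty t c y - outScore pluralityVec P M c)
      hy.symm (by simp) (by
        rw [sum_tsub_distrib _ fun c _ => Nat.le_sub_of_add_le (hout c)]
        omega)
    refine ⟨P', hP', fun c => ?_⟩
    have := hout c
    have := hcap c
    omega

theorem exists_score_eq_outScore_add (hm : 0 < m) {e : Fin m → ℕ}
    (he : ∀ c, e c ≤ score pluralityVec P c) :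
    ∃ M : Finset (Fin n), #M = ∑ c, e c ∧
      ∀ c, score pluralityVec P c = outScore pluralityVec P M c + e c := by
  have hT : ∀ c, ∃ T ⊆ ({v | P v ⟨0, hm⟩ = c} : Finset (Fin n)), #T = e c := fun c =>
    exists_subset_card_eq ((he c).trans_eq (sum_pluralityVec hm P univ c))
  choose T hTs hTc using hT
  set M : Finset (Fin n) := {v | v ∈ T (P v ⟨0, hm⟩)}
  have hMT : ∀ c, {v ∈ M | P v ⟨0, hm⟩ = c} = T c := fun c => by
    ext v
    rw [mem_filter, mem_filter_univ]
    refine ⟨fun h => h.2 ▸ h.1, fun h => ?_⟩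
    have hv : P v ⟨0, hm⟩ = c := (mem_filter.1 (hTs c h)).2
    exact ⟨by rwa [hv], hv⟩
  have hMe : ∀ c, ∑ v ∈ M, pluralityVec ((P v).symm c) = e c := fun c => by
    rw [sum_pluralityVec hm, hMT, hTc]
  refine ⟨M, ?_, fun c => ?_⟩
  · rw [← sum_sum_pluralityVec hm P M, sum_congr rfl fun c _ => hMe c]
  · rw [score_eq_outScore_add pluralityVec P M c, hMe]

theorem exists_isCoalitionAgainst_plurality_iff (hn : 0 < n) (k : ℕ) :
    (∃ M : Finset (Fin n), #M ≤ k ∧ IsCoalitionAgainst (scoringRule hm pluralityVec t) P M y) ↔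
      y ≠ scoringRule hm pluralityVec t P ∧
      ∑ c, (score pluralityVec P c - (score pluralityVec P y - tiePenalty t c y)) ≤ k ∧
      n ≤ ∑ c, (score pluralityVec P y - tiePenalty t c y) := by
  simp only [isCoalitionAgainst_plurality_iff]
  constructor
  · rintro ⟨M, hM, hy, hout, hsum⟩
    have hs := score_eq_outScore_add pluralityVec P M
    refine ⟨hy, hM.trans' ?_, hsum.trans (sum_le_sum fun c _ => Nat.sub_le_sub_right ?_ _)⟩
    · rw [← sum_sum_pluralityVec hm P M]
      refine sum_le_sum fun c _ => ?_
      have := hout c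
      have := hs c
      have := hs y
      omega
    · exact (hs y).ge.trans' (Nat.le_add_right _ _)
  · rintro ⟨hy, hk, hsum⟩
    have hpos : 0 < score pluralityVec P y := by
      by_contra! h0
      simp only [Nat.le_zero.1 h0, zero_tsub, sum_const_zero] at hsum
      omega
    obtain ⟨M, hM, hs⟩ := exists_score_eq_outScore_add (P := P) hm fun c =>
      Nat.sub_le (score pluralityVec P c) (score pluralityVec P y - tiePenalty t c y)
    have hsy : outScore pluralityVec P M y = score pluralityVec P y := by
      have := hs y
      rw [tiePenalty_self] at this
      omega
    refine ⟨M, hM.trans_le hk, hy, fun c => ?_, by rwa [hsy]⟩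
    have htie : tiePenalty t c y ≤ 1 := by
      unfold tiePenalty
      split_ifs <;> omega
    have := hs c
    omega

end Plurality

/-! ### Inputs that describe elections -/

/-- The score vector used in the election. -/
abbrev Election.vec {F : ScoringFamily} (E : Election F) : Fin E.m → ℕ := F.vec E.m E.param

/-- Each input word describes the election `E x`, preceded by `o` other lists of numbers. -/
def Encodes {X : Type} [Context X] {F : ScoringFamily} (o : ℕ) (E : X → Election F) : Prop :=
  ∀ x, ∃ pre : List (List ℕ), pre.length = o ∧ word x = encodeLists (pre ++ (E x).toLists)

/-- The entries of the score vectors of the family can be computed in polynomial time from inputs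
that describe elections. -/
def ScoringFamily.IsPolyTime (F : ScoringFamily) : Prop :=
  ∀ ⦃X : Type⦄ [Context X] ⦃o : ℕ⦄ ⦃E : X → Election F⦄, Encodes o E → ∀ ⦃p : ∀ x, Fin (E x).m⦄,
    PolyTimeFun (fun x => (p x : ℕ)) → PolyTimeFun fun x => (E x).vec (p x)

namespace Encodes

variable {X : Type} [Context X] {F : ScoringFamily} {o : ℕ} {E : X → Election F}

theorem comp_fst_fin (hE : Encodes o E) (n : X → ℕ) :
    Encodes o fun y : (x : X) × Fin (n x) => E y.1 :=
  fun y => hE y.1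

theorem m_le_length_word (hE : Encodes o E) (x : X) : (E x).m ≤ (word x).length := by
  obtain ⟨pre, rfl, h⟩ := hE x
  have := length_getD_le_length_encodeLists (pre ++ (E x).toLists) (pre.length + 1)
  rw [h]
  simpa [Election.toLists, Pref.toList] using this

theorem n_le_length_word (hE : Encodes o E) (x : X) : (E x).n ≤ (word x).length := by
  obtain ⟨pre, rfl, h⟩ := hE x
  have := length_le_length_encodeLists (pre ++ (E x).toLists)
  rw [← h] at this
  simp only [List.length_append, Election.toLists, List.length_cons, List.length_ofFn] at this
  omega

theorem polyTimeFun_m (hE : Encodes o E) : PolyTimeFun fun x => (E x).m := by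
  choose pre hpre hword using hE
  refine (polyTimeFun_length_getD hword (.const (o + 1))).congr fun x => ?_
  simp [← hpre x, Election.toLists, Pref.toList]

theorem polyTimeFun_n (hE : Encodes o E) : PolyTimeFun fun x => (E x).n := by
  choose pre hpre hword using hE
  refine ((polyTimeFun_length_lists hword).tsub (.const (o + 2))).congr fun x => ?_
  simp only [List.length_append, hpre x, Election.toLists, List.length_cons, List.length_ofFn]
  omega

theorem polyTimeFun_tie_symm (hE : Encodes o E) {c : ∀ x, Fin (E x).m}
    (hc : PolyTimeFun fun x => (c x : ℕ)) : PolyTimeFun fun x => ((E x).tie.symm (c x) : ℕ) := by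
  have hm := hE.polyTimeFun_m
  choose pre hpre hword using hE
  exact polyTimeFun_symm_apply hword hm (.const (o + 1))
    (fun x => by simp [← hpre x, Election.toLists]) hc

theorem polyTimeFun_votes_symm (hE : Encodes o E) {v : ∀ x, Fin (E x).n} {c : ∀ x, Fin (E x).m}
    (hv : PolyTimeFun fun x => (v x : ℕ)) (hc : PolyTimeFun fun x => (c x : ℕ)) :
    PolyTimeFun fun x => (((E x).votes (v x)).symm (c x) : ℕ) := by
  have hm := hE.polyTimeFun_m
  choose pre hpre hword using hE
  refine polyTimeFun_symm_apply hword hm ((PolyTimeFun.const (o + 2)).add hv)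
    (fun x => ?_) hc
  rw [← hpre x, add_assoc, List.getD_append_right _ _ _ _ (Nat.le_add_right _ _),
    Nat.add_sub_cancel_left, add_comm]
  simp [Election.toLists]

/-! ### Scores and winners -/

theorem polyTimeFun_vec_symm (hF : F.IsPolyTime) (hE : Encodes o E) {v : ∀ x, Fin (E x).n}
    {c : ∀ x, Fin (E x).m} (hv : PolyTimeFun fun x => (v x : ℕ))
    (hc : PolyTimeFun fun x => (c x : ℕ)) :
    PolyTimeFun fun x => (E x).vec (((E x).votes (v x)).symm (c x)) :=
  hF hE (hE.polyTimeFun_votes_symm hv hc)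

theorem polyTimeFun_score (hF : F.IsPolyTime) (hE : Encodes o E) {c : ∀ x, Fin (E x).m}
    (hc : PolyTimeFun fun x => (c x : ℕ)) :
    PolyTimeFun fun x => score (E x).vec (E x).votes (c x) :=
  hE.polyTimeFun_n.sum ((hE.comp_fst_fin _).polyTimeFun_vec_symm hF .snd_fin hc.comp_fst_fin)

theorem polyTimeFun_outScore (hF : F.IsPolyTime) (hE : Encodes o E) {M : ∀ x, Finset (Fin (E x).n)}
    (hM : PolyTimePred fun y : (x : X) × Fin (E x).n => y.2 ∈ M y.1) {c : ∀ x, Fin (E x).m}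
    (hc : PolyTimeFun fun x => (c x : ℕ)) :
    PolyTimeFun fun x => outScore (E x).vec (E x).votes (M x) (c x) :=
  hE.polyTimeFun_n.sum
    (.ite hM .zero ((hE.comp_fst_fin _).polyTimeFun_vec_symm hF .snd_fin hc.comp_fst_fin))

theorem polyTimeFun_card (hE : Encodes o E) {M : ∀ x, Finset (Fin (E x).n)}
    (hM : PolyTimePred fun y : (x : X) × Fin (E x).n => y.2 ∈ M y.1) :
    PolyTimeFun fun x => #(M x) :=
  (hE.polyTimeFun_n.sum (.ite hM (.const 1) .zero)).congr fun x => by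
    rw [← card_filter]
    congr 1
    ext
    simp

theorem polyTimeFun_tiePenalty (hE : Encodes o E) {c y : ∀ x, Fin (E x).m}
    (hc : PolyTimeFun fun x => (c x : ℕ)) (hy : PolyTimeFun fun x => (y x : ℕ)) :
    PolyTimeFun fun x => tiePenalty (E x).tie (c x) (y x) :=
  .ite (.lt (hE.polyTimeFun_tie_symm hc) (hE.polyTimeFun_tie_symm hy)) (.const 1) .zero

theorem polyTimePred_rule_eq (hF : F.IsPolyTime) (hE : Encodes o E) {y : ∀ x, Fin (E x).m}
    (hy : PolyTimeFun fun x => (y x : ℕ)) :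
    PolyTimePred fun x => (E x).rule (E x).votes = y x :=
  (PolyTimePred.forall_fin hE.polyTimeFun_m (.le
    (((hE.comp_fst_fin _).polyTimeFun_score hF .snd_fin).add
      ((hE.comp_fst_fin _).polyTimeFun_tiePenalty .snd_fin hy.comp_fst_fin))
    (hE.polyTimeFun_score hF hy).comp_fst_fin)).congr fun x => by
    rw [Election.rule, scoringRule_eq_iff]

theorem polyTimeFun_rule (hF : F.IsPolyTime) (hE : Encodes o E) :
    PolyTimeFun fun x => ((E x).rule (E x).votes : ℕ) :=
  (hE.polyTimeFun_m.sum
    (.ite ((hE.comp_fst_fin _).polyTimePred_rule_eq hF .snd_fin) .snd_fin .zero)).congr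
    fun x => by simp

theorem polyTimePred_vec_eq_pluralityVec (hF : F.IsPolyTime) (hE : Encodes o E) :
    PolyTimePred fun x => (E x).vec = pluralityVec :=
  (PolyTimePred.forall_fin hE.polyTimeFun_m (.eq (hF (hE.comp_fst_fin _) .snd_fin)
    (.ite (.eq .snd_fin .zero) (.const 1) .zero))).congr fun _ => funext_iff.symm

/-! ### Deciding whether a coalition can manipulate -/

variable {g : ℕ} {M : ∀ x, Finset (Fin (E x).n)} {y : ∀ x, Fin (E x).m} {k : X → ℕ}

theorem polyTimePred_outScore_gap (hF : F.IsPolyTime) (hE : Encodes o E)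
    (hM : PolyTimePred fun y : (x : X) × Fin (E x).n => y.2 ∈ M y.1)
    (hy : PolyTimeFun fun x => (y x : ℕ)) (g : ℕ) :
    PolyTimePred fun x => outScore (E x).vec (E x).votes (M x) ((E x).rule (E x).votes) +
      g * #(M x) + tiePenalty (E x).tie ((E x).rule (E x).votes) (y x) ≤
        outScore (E x).vec (E x).votes (M x) (y x) :=
  have hwin := hE.polyTimeFun_rule hF
  .le (((hE.polyTimeFun_outScore hF hM hwin).add ((PolyTimeFun.const g).mul
    (hE.polyTimeFun_card hM))).add (hE.polyTimeFun_tiePenalty hwin hy))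
    (hE.polyTimeFun_outScore hF hM hy)

theorem polyTimePred_outScore_plurality (hF : F.IsPolyTime) (hE : Encodes o E)
    (hM : PolyTimePred fun y : (x : X) × Fin (E x).n => y.2 ∈ M y.1)
    (hy : PolyTimeFun fun x => (y x : ℕ)) :
    PolyTimePred fun x =>
      (∀ c, outScore (E x).vec (E x).votes (M x) c + tiePenalty (E x).tie c (y x) ≤
        outScore (E x).vec (E x).votes (M x) (y x)) ∧
      (E x).n ≤ ∑ c, (outScore (E x).vec (E x).votes (M x) (y x) -
        tiePenalty (E x).tie c (y x)) := by
  have hE' := hE.comp_fst_fin fun x => (E x).m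
  have htie : PolyTimeFun fun z : (x : X) × Fin (E x).m => tiePenalty (E z.1).tie z.2 (y z.1) :=
    hE'.polyTimeFun_tiePenalty .snd_fin hy.comp_fst_fin
  have hout : PolyTimeFun fun z : (x : X) × Fin (E x).m =>
      outScore (E z.1).vec (E z.1).votes (M z.1) z.2 :=
    hE'.polyTimeFun_outScore hF (hM.comp_fst_fst_fin _) .snd_fin
  have houty : PolyTimeFun fun z : (x : X) × Fin (E x).m =>
      outScore (E z.1).vec (E z.1).votes (M z.1) (y z.1) :=
    (hE.polyTimeFun_outScore hF hM hy).comp_fst_fin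
  exact .and (.forall_fin hE.polyTimeFun_m (.le (hout.add htie) houty))
    (.le hE.polyTimeFun_n (hE.polyTimeFun_m.sum (houty.tsub htie)))

theorem polyTimePred_isCoalitionAgainst (hF : F.IsPolyTime)
    (hgap : ∀ m a, HasMinGap (F.vec m a) g ∨ F.vec m a = pluralityVec) (hE : Encodes o E)
    (hM : PolyTimePred fun y : (x : X) × Fin (E x).n => y.2 ∈ M y.1)
    (hy : PolyTimeFun fun x => (y x : ℕ)) :
    PolyTimePred fun x => IsCoalitionAgainst (E x).rule (E x).votes (M x) (y x) := by
  have hplur := hE.polyTimePred_vec_eq_pluralityVec hF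
  refine ((hE.polyTimePred_rule_eq hF hy).not.and
    ((hplur.and (hE.polyTimePred_outScore_plurality hF hM hy)).or
      (hplur.not.and (hE.polyTimePred_outScore_gap hF hM hy g)))).congr fun x => ?_
  by_cases h : (E x).vec = pluralityVec
  · simp only [Election.rule, h, not_true_eq_false, true_and, false_and, or_false, ← ne_eq]
    rw [isCoalitionAgainst_plurality_iff, ne_comm]
  · simp only [Election.rule, h, not_false_eq_true, true_and, false_and, false_or, ← ne_eq]
    rw [isCoalitionAgainst_iff_of_hasMinGap ((hgap _ _).resolve_right h), ne_comm]

/-! ### Deciding whether there is a small coalition -/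

theorem polyTimePred_score_gap (hF : F.IsPolyTime) (hE : Encodes o E) (hk : PolyTimeFun k)
    (hy : PolyTimeFun fun x => (y x : ℕ)) (g : ℕ) :
    PolyTimePred fun x => score (E x).vec (E x).votes ((E x).rule (E x).votes) +
        tiePenalty (E x).tie ((E x).rule (E x).votes) (y x) ≤
      score (E x).vec (E x).votes (y x) + ∑ j : Fin (∑ p, (E x).vec p), min (k x)
        #{v | (j : ℕ) < (E x).vec (((E x).votes v).symm ((E x).rule (E x).votes)) -
          ((E x).vec (((E x).votes v).symm (y x)) + g)} := by
  have hwin := hE.polyTimeFun_rule hF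
  have hbound : PolyTimeFun fun x => ∑ p, (E x).vec p :=
    hE.polyTimeFun_m.sum (hF (hE.comp_fst_fin _) .snd_fin)
  have hE' := (hE.comp_fst_fin fun x => ∑ p, (E x).vec p).comp_fst_fin fun z => (E z.1).n
  have hlt : PolyTimePred fun z : (z : (x : X) × Fin (∑ p, (E x).vec p)) × Fin (E z.1).n =>
      (z.1.2 : ℕ) <
        (E z.1.1).vec (((E z.1.1).votes z.2).symm ((E z.1.1).rule (E z.1.1).votes)) -
          ((E z.1.1).vec (((E z.1.1).votes z.2).symm (y z.1.1)) + g) :=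
    .lt PolyTimeFun.snd_fin.comp_fst_fin
      ((hE'.polyTimeFun_vec_symm hF .snd_fin hwin.comp_fst_fin.comp_fst_fin).tsub
        ((hE'.polyTimeFun_vec_symm hF .snd_fin hy.comp_fst_fin.comp_fst_fin).add (.const g)))
  have hcard : PolyTimeFun fun z : (x : X) × Fin (∑ p, (E x).vec p) =>
      #{v | (z.2 : ℕ) < (E z.1).vec (((E z.1).votes v).symm ((E z.1).rule (E z.1).votes)) -
        ((E z.1).vec (((E z.1).votes v).symm (y z.1)) + g)} :=
    (hE.polyTimeFun_n.comp_fst_fin.sum (.ite hlt (.const 1) .zero)).congr fun z => by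
      rw [card_filter]
  exact .le ((hE.polyTimeFun_score hF hwin).add (hE.polyTimeFun_tiePenalty hwin hy))
    ((hE.polyTimeFun_score hF hy).add (hbound.sum (hk.comp_fst_fin.min hcard)))

theorem polyTimePred_score_plurality (hF : F.IsPolyTime) (hE : Encodes o E) (hk : PolyTimeFun k)
    (hy : PolyTimeFun fun x => (y x : ℕ)) :
    PolyTimePred fun x =>
      ∑ c, (score (E x).vec (E x).votes c -
        (score (E x).vec (E x).votes (y x) - tiePenalty (E x).tie c (y x))) ≤ k x ∧
      (E x).n ≤ ∑ c, (score (E x).vec (E x).votes (y x) - tiePenalty (E x).tie c (y x)) := by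
  have hE' := hE.comp_fst_fin fun x => (E x).m
  have hcap : PolyTimeFun fun z : (x : X) × Fin (E x).m =>
      score (E z.1).vec (E z.1).votes (y z.1) - tiePenalty (E z.1).tie z.2 (y z.1) :=
    (hE'.polyTimeFun_score hF hy.comp_fst_fin).tsub
      (hE'.polyTimeFun_tiePenalty .snd_fin hy.comp_fst_fin)
  have hexcess : PolyTimeFun fun z : (x : X) × Fin (E x).m =>
      score (E z.1).vec (E z.1).votes z.2 -
        (score (E z.1).vec (E z.1).votes (y z.1) - tiePenalty (E z.1).tie z.2 (y z.1)) :=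
    (hE'.polyTimeFun_score hF .snd_fin).tsub hcap
  exact .and (.le (hE.polyTimeFun_m.sum hexcess) hk)
    (.le hE.polyTimeFun_n (hE.polyTimeFun_m.sum hcap))

theorem polyTimePred_exists_isCoalitionAgainst (hF : F.IsPolyTime)
    (hgap : ∀ m a, HasMinGap (F.vec m a) g ∨ F.vec m a = pluralityVec) (hE : Encodes o E)
    (hk : PolyTimeFun k) (hy : PolyTimeFun fun x => (y x : ℕ)) :
    PolyTimePred fun x =>
      ∃ M, #M ≤ k x ∧ IsCoalitionAgainst (E x).rule (E x).votes M (y x) := by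
  have hplur := hE.polyTimePred_vec_eq_pluralityVec hF
  refine ((hE.polyTimePred_rule_eq hF hy).not.and
    ((hplur.and (hE.polyTimePred_score_plurality hF hk hy)).or
      (hplur.not.and (hE.polyTimePred_score_gap hF hk hy g)))).congr fun x => ?_
  by_cases h : (E x).vec = pluralityVec
  · simp only [Election.rule, h, not_true_eq_false, true_and, false_and, or_false, ← ne_eq]
    rw [exists_isCoalitionAgainst_plurality_iff (E x).n_pos, ne_comm]
  · simp only [Election.rule, h, not_false_eq_true, true_and, false_and, false_or, ← ne_eq]
    rw [exists_isCoalitionAgainst_iff_of_hasMinGap ((hgap _ _).resolve_right h)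
      fun i => single_le_sum (f := (E x).vec) (fun _ _ => Nat.zero_le _) (mem_univ i), ne_comm]
    rfl

end Encodes

/-! ### Membership of the four problems in P -/

section InP

variable {F : ScoringFamily} {g : ℕ}

theorem mem_iff_getD_voterSetToList {n : ℕ} (M : Finset (Fin n)) (v : Fin n) :
    v ∈ M ↔ 0 < (voterSetToList M).getD v 0 := by
  rw [voterSetToList, List.getD_eq_getElem _ _ (by simp), List.getElem_ofFn]
  split_ifs with h <;> simp [h]

theorem polyTimePred_mem {X : Type} [Context X] {n : X → ℕ} {M : ∀ x, Finset (Fin (n x))}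
    {L : X → List (List ℕ)} (h : ∀ x, word x = encodeLists (voterSetToList (M x) :: L x)) :
    PolyTimePred fun y : (x : X) × Fin (n x) => y.2 ∈ M y.1 := by
  refine (PolyTimePred.lt .zero (polyTimeFun_min_getD_getD (fun y => h y.1) .zero
    .snd_fin)).congr fun y => ?_
  have hlen := length_getD_le_length_encodeLists (voterSetToList (M y.1) :: L y.1) 0
  rw [← h, List.getD_cons_zero, voterSetToList, List.length_ofFn] at hlen
  have hpos := (y.2.pos.trans_le hlen)
  rw [mem_iff_getD_voterSetToList, lt_min_iff]
  exact and_iff_left hpos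

theorem exists_card_le_min_iff {n k l : ℕ} (h : n ≤ l) {p : Finset (Fin n) → Prop} :
    (∃ M, #M ≤ min k l ∧ p M) ↔ ∃ M, #M ≤ k ∧ p M :=
  exists_congr fun M => by
    rw [le_min_iff, and_iff_left (show #M ≤ l from (card_le_univ M).trans (by simpa))]

variable (hF : F.IsPolyTime)
  (hgap : ∀ m a, HasMinGap (F.vec m a) g ∨ F.vec m a = pluralityVec)

include hF hgap

theorem inP_CPMW : (CPMW F).InP := by
  have hword (I : (CPMW F).Inst) :
      word I = encodeLists (voterSetToList I.2.1 :: [(I.2.2 : ℕ)] :: I.1.toLists) := rfl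
  have hE : Encodes 2 fun I : (CPMW F).Inst => I.1 := fun I => ⟨[_, _], rfl, hword I⟩
  have hy : PolyTimeFun fun I : (CPMW F).Inst => (I.2.2 : ℕ) :=
    polyTimeFun_getD_getD hword (.const 1) .zero fun I =>
      I.2.2.is_lt.le.trans (hE.m_le_length_word I)
  exact DecisionProblem.inP_of_polyTimePred
    (hE.polyTimePred_isCoalitionAgainst hF hgap (polyTimePred_mem hword) hy)

theorem inP_CPM : (CPM F).InP := by
  have hword (I : (CPM F).Inst) : word I = encodeLists (voterSetToList I.2 :: I.1.toLists) := rfl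
  have hE : Encodes 1 fun I : (CPM F).Inst => I.1 := fun I => ⟨[_], rfl, hword I⟩
  have hM := (polyTimePred_mem hword).comp_fst_fst_fin fun I => I.1.m
  have hy := (hE.comp_fst_fin fun I => I.1.m).polyTimePred_isCoalitionAgainst hF hgap
    (M := fun z => z.1.2) hM .snd_fin
  exact DecisionProblem.inP_of_polyTimePred (.exists_fin hE.polyTimeFun_m hy)

theorem inP_CPMSW : (CPMSW F).InP := by
  have hword (I : (CPMSW F).Inst) :
      word I = encodeLists ([(I.2.1 : ℕ)] :: [I.2.2] :: I.1.toLists) := rfl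
  have hE : Encodes 2 fun I : (CPMSW F).Inst => I.1 := fun I => ⟨[_, _], rfl, hword I⟩
  have hy : PolyTimeFun fun I : (CPMSW F).Inst => (I.2.1 : ℕ) :=
    polyTimeFun_getD_getD hword .zero .zero fun I =>
      I.2.1.is_lt.le.trans (hE.m_le_length_word I)
  have hk : PolyTimeFun fun I : (CPMSW F).Inst => min I.2.2 (word I).length :=
    polyTimeFun_min_getD_getD hword (.const 1) .zero
  exact DecisionProblem.inP_of_polyTimePred <|
    (hE.polyTimePred_exists_isCoalitionAgainst hF hgap hk hy).congr fun I =>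
      exists_card_le_min_iff (hE.n_le_length_word I)

theorem inP_CPMS : (CPMS F).InP := by
  have hword (I : (CPMS F).Inst) : word I = encodeLists ([I.2] :: I.1.toLists) := rfl
  have hE : Encodes 1 fun I : (CPMS F).Inst => I.1 := fun I => ⟨[_], rfl, hword I⟩
  have hk : PolyTimeFun fun I : (CPMS F).Inst => min I.2 (word I).length :=
    polyTimeFun_min_getD_getD hword .zero .zero
  have hy := (hE.comp_fst_fin fun I => I.1.m).polyTimePred_exists_isCoalitionAgainst hF hgap
    hk.comp_fst_fin .snd_fin
  refine DecisionProblem.inP_of_polyTimePred ((hy.exists_fin hE.polyTimeFun_m).congr fun I => ?_)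
  simp only [exists_card_le_min_iff (hE.n_le_length_word I)]
  rw [exists_comm]
  exact exists_congr fun M => exists_and_left

end InP

/-! ### Borda and approval -/

theorem hasMinGap_borda (m : ℕ) (a : borda.Param m) : HasMinGap (borda.vec m a) 1 where
  add_le i j h := by
    have := Fin.lt_def.1 h
    simp only [borda]
    omega
  top i₀ i₁ h₀ h₁ := by
    simp only [borda, h₀, h₁]
    omega

theorem hasMinGap_approval {m : ℕ} {a : approval.Param m} (h : a.1 ≠ 1) :
    HasMinGap (approval.vec m a) 0 where
  add_le i j h := by
    have := Fin.lt_def.1 h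
    simp only [approval]
    split_ifs <;> omega
  top i₀ i₁ h₀ h₁ := by
    have := a.2.1
    simp only [approval, h₀, h₁]
    split_ifs <;> omega

theorem approval_vec_eq_pluralityVec {m : ℕ} {a : approval.Param m} (h : a.1 = 1) :
    approval.vec m a = pluralityVec := by
  funext p
  simp only [approval, pluralityVec, h, Nat.lt_one_iff]

theorem isPolyTime_borda : borda.IsPolyTime := fun _ _ _ _ hE _ hp =>
  (hE.polyTimeFun_m.tsub (.const 1)).tsub hp

theorem isPolyTime_approval : approval.IsPolyTime := by
  intro X _ o E hE p hp
  refine .ite (.lt hp ?_) (.const 1) .zero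
  have hle (x : X) : (E x).param.1 ≤ (word x).length :=
    (E x).param.2.2.le.trans (hE.m_le_length_word x)
  choose pre hpre hword using hE
  have hparam (x : X) : ((pre x ++ (E x).toLists).getD o []).getD 0 0 = (E x).param.1 := by
    simp [← hpre x, Election.toLists, approval]
  exact (polyTimeFun_getD_getD hword (.const o) .zero fun x => (hparam x).trans_le (hle x)).congr
    hparam

end Manip

open Manip in
theorem mainTheorem4_general (F : ScoringFamily) (hF : F.IsPolyTime) (g : ℕ)
    (hgap : ∀ m a, HasMinGap (F.vec m a) g ∨ F.vec m a = pluralityVec) :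
    (CPMW F).InP ∧ (CPM F).InP ∧ (CPMSW F).InP ∧ (CPMS F).InP :=
  ⟨inP_CPMW hF hgap, inP_CPM hF hgap, inP_CPMSW hF hgap, inP_CPMS hF hgap⟩

theorem mainTheorem4 :
    ((Manip.CPMW Manip.borda).InP ∧ (Manip.CPM Manip.borda).InP ∧
      (Manip.CPMSW Manip.borda).InP ∧ (Manip.CPMS Manip.borda).InP) ∧
    ((Manip.CPMW Manip.approval).InP ∧ (Manip.CPM Manip.approval).InP ∧
      (Manip.CPMSW Manip.approval).InP ∧ (Manip.CPMS Manip.approval).InP) :=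
  ⟨mainTheorem4_general _ Manip.isPolyTime_borda 1 fun m a => .inl (Manip.hasMinGap_borda m a),
    mainTheorem4_general _ Manip.isPolyTime_approval 0 fun _ a =>
      (eq_or_ne a.1 1).symm.imp Manip.hasMinGap_approval Manip.approval_vec_eq_pluralityVec⟩
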